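/- **Conventions.** Let $M\cong\mathbb Z^d$ be a lattice, $M_{\mathbb R}=M\otimes\mathbb R$, and $N_{\mathbb R}$ the dual space of $M_{\mathbb R}$, with dual lattice $N$. A *Fano polytope* is a lattice polytope $P\subseteq M_{\mathbb R}$ with $0$ in its interior all of whose vertices are primitive lattice points; it is *reflexive* if $P^*=\{u\in N_{\mathbb R}:\langle u,y\rangle\ge -1\ \forall y\in P\}$ is a lattice polytope (with respect to $N$). A *cs-crosspolytope* is $\mathrm{conv}(\pm e_1,\dots,\pm e_d)$ for an $\mathbb R$-basis $e_1,\dots,e_d$ of $M_{\mathbb R}$. Polytopes are *isomorphic* ($\cong$) if a linear isomorphism of the ambient spaces identifies the lattices and the polytopes. $P$ *splits* into $P_1,P_2$ (with lattices $M_1,M_2$) if $P\cong\mathrm{conv}(P_1\oplus\{0\},\{0\}\oplus P_2)$ with respect to $M_1\oplus M_2$; similarly for several factors. A Fano polytope is *1-irreducible* if it does not split into $[-1,1]$ (with lattice $\mathbb Z$) and a Fano polytope $P_2$. In dimension $0$ the polytope $\{0\}$ is counted as a Fano polytope and as a reflexive cs-crosspolytope, and it is admitted as a factor $P_2$; thus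 $[-1,1]$ is not 1-irreducible. A *Wirth matrix* of size $d$ is a matrix $A=\begin{pmatrix}2\,\mathrm{id}_f&0\\ C&\mathrm{id}_{d-f}\end{pmatrix}$ with $0\le f\le d-1$ and $C\in\mathrm{Mat}_{(d-f)\times f}(\{0,1\})$ such that every column of $C$ contains an odd number of $1$'s; the empty matrix ($d=0$) is also admitted. It is *1-minimal* if every row of $C$ contains a $1$. Its *reduction* is obtained by deleting all rows of $A$ that contain exactly one $1$, together with the columns of the same indices. Two $d\times d$ matrices are *equivalent* if they differ by a permutation of the columns and left multiplication by an element of $\mathrm{GL}_d(\mathbb Z)$. A matrix $A$ of size $d$ *defines* $P$ if, in some lattice basis of $M$, $P$ is the convex hull of $0$, the columns of $A$ and their negatives ($0$ matters only if $d=0$). **Theorem (Wirth, Nill).** 1. Every Wirth matrix of size $d$ defines, in every lattice basis of $M$, a reflexive cs-crosspolytope, and this induces a bijection between equivalence classes of Wirth matrices of size $d$ and isomorphism classes of reflexive cs-crosspolytopes in $M_{\mathbb R}$. Inversely, for every facet $F$ of a reflexive cs-crosspolytope $P$ there is a lattice basis of $M$ in which the coordinate vectors of the vertices of $F$, suitably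 ordered, are the columns of a Wirth matrix in the class corresponding to $P$. 2. Let $A$ be a Wirth matrix in the class corresponding to the reflexive cs-crosspolytope $P$. Then $A$ is 1-minimal if and only if $P$ is 1-irreducible; so the bijection restricts to one between equivalence classes of 1-minimal Wirth matrices and isomorphism classes of 1-irreducible reflexive cs-crosspolytopes. Moreover let $r$ be the number of rows of $A$ containing exactly one $1$. Then the reduction $A'$ of $A$ is a 1-minimal Wirth matrix, the polytope $P'$ it defines is a 1-irreducible reflexive cs-crosspolytope, and $P$ splits into $P'$ and $r$ copies of $[-1,1]$. This splitting is unique: if $P$ splits into a 1-irreducible reflexive cs-crosspolytope $Q$ and $s$ copies of $[-1,1]$, then $s=r$ and $Q\cong P'$. -/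

import Mathlib

noncomputable section

namespace CSCross

open Module

/-! ### Lattices, lattice polytopes, reflexive polytopes

The real vector space `V` stands for the ambient space of the lattice `L`, a full rank lattice in `V`. -/

section Polytopes

variable {V : Type*} [NormedAddCommGroup V] [NormedSpace ℝ V]

/-- The standard lattice `ℤ^n` in `ℝ^n`. -/
abbrev stdLattice (n : ℕ) : Submodule ℤ (Fin n → ℝ) :=
  Submodule.span ℤ (Set.range (Pi.basisFun ℝ (Fin n)))

/-- The lattice `ℤ` in `ℝ`. -/
abbrev intLattice : Submodule ℤ ℝ := Submodule.span ℤ {(1 : ℝ)}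

/-- The dual lattice: linear forms with integral values on `L`. -/
def dualLattice {V : Type*} [AddCommGroup V] [Module ℝ V] (L : Submodule ℤ V) :
    Submodule ℤ (Dual ℝ V) where
  carrier := {u | ∀ x ∈ L, ∃ n : ℤ, u x = n}
  add_mem' := by
    intro u w hu hw x hx
    obtain ⟨m, hm⟩ := hu x hx
    obtain ⟨n, hn⟩ := hw x hx
    exact ⟨m + n, by simp [hm, hn]⟩
  zero_mem' := fun x _ => ⟨0, by simp⟩
  smul_mem' := by
    intro c u hu x hx
    obtain ⟨m, hm⟩ := hu x hx
    exact ⟨c * m, by simp [hm]⟩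

/-- A lattice polytope is the convex hull of finitely many lattice points. -/
def IsLatticePolytope {V : Type*} [AddCommGroup V] [Module ℝ V] (L : Submodule ℤ V)
    (P : Set V) : Prop :=
  ∃ S : Finset V, (S : Set V) ⊆ (L : Set V) ∧ P = convexHull ℝ (S : Set V)

/-- A lattice point is primitive if it is not a (nonnegative integral) multiple of another lattice
point. (In the zero lattice the point `0` is primitive.) -/
def IsPrimitivePoint (L : Submodule ℤ V) (v : V) : Prop :=
  v ∈ L ∧ ∀ w ∈ L, ∀ k : ℕ, v = k • w → w = v

/-- Fano polytopes: lattice polytopes with `0` in the interior, all of whose vertices are primitive.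
The point `{0}` in the zero space is a Fano polytope. -/
def IsFano (L : Submodule ℤ V) (P : Set V) : Prop :=
  IsLatticePolytope L P ∧ (0 : V) ∈ interior P ∧
    ∀ v ∈ P.extremePoints ℝ, IsPrimitivePoint L v

/-- The dual polytope `P^* = {u : ⟨u, y⟩ ≥ -1 for all y in P}`. -/
def dualPolytope (P : Set V) : Set (Dual ℝ V) := {u | ∀ y ∈ P, -1 ≤ u y}

/-- Reflexive polytopes: Fano polytopes whose dual is a lattice polytope. -/
def IsReflexivePolytope (L : Submodule ℤ V) (P : Set V) : Prop :=
  IsFano L P ∧ IsLatticePolytope (dualLattice L) (dualPolytope P)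

/-- The convex hull of the points `± v i`. The point `0 = (v i + (- v i)) / 2` is listed only in
order to get `{0}` and not the empty set when the index type is empty. -/
def crossHull {ι : Type*} (v : ι → V) : Set V :=
  convexHull ℝ ({0} ∪ Set.range v ∪ Set.range (fun i => -v i))

/-- Full-dimensional centrally symmetric crosspolytopes: the convex hull of the `(d-1)`-simplex on a
vector space basis `e 0, …, e (d-1)` and of its negative. In dimension zero this is `{0}`. -/
def IsCSCrosspolytope (P : Set V) : Prop :=
  ∃ e : Basis (Fin (finrank ℝ V)) ℝ V, P = crossHull e

/-- Facets of a full-dimensional polytope: nonempty (exposed) faces of codimension one. -/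
def IsFacet (P F : Set V) : Prop :=
  IsExposed ℝ P F ∧ F.Nonempty ∧ finrank ℝ (vectorSpan ℝ F) + 1 = finrank ℝ V

/-- The convex hull of the columns of `A`, read as coordinate vectors with respect to `b`, and of
their negatives. -/
def matrixPolytope {n : ℕ} (b : Fin n → V) (A : Matrix (Fin n) (Fin n) ℤ) : Set V :=
  crossHull (fun j => ∑ i, A i j • b i)

end Polytopes

section Isomorphism

variable {V : Type*} [NormedAddCommGroup V] [NormedSpace ℝ V]
variable {V₁ : Type*} [NormedAddCommGroup V₁] [NormedSpace ℝ V₁]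
variable {V₂ : Type*} [NormedAddCommGroup V₂] [NormedSpace ℝ V₂]

/-- Unimodular isomorphism: a linear isomorphism of the ambient spaces that identifies the lattices
and the polytopes. -/
def Iso (L₁ : Submodule ℤ V₁) (P₁ : Set V₁) (L₂ : Submodule ℤ V₂) (P₂ : Set V₂) : Prop :=
  ∃ e : V₁ ≃ₗ[ℝ] V₂, (∀ x, e x ∈ L₂ ↔ x ∈ L₁) ∧ e '' P₁ = P₂

theorem Iso.refl (L : Submodule ℤ V) (P : Set V) : Iso L P L P :=
  ⟨LinearEquiv.refl ℝ V, fun _ => Iff.rfl, Set.image_id P⟩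

theorem Iso.symm {L₁ : Submodule ℤ V₁} {P₁ : Set V₁} {L₂ : Submodule ℤ V₂} {P₂ : Set V₂}
    (h : Iso L₁ P₁ L₂ P₂) : Iso L₂ P₂ L₁ P₁ := by
  obtain ⟨e, he, rfl⟩ := h
  refine ⟨e.symm, fun x => ?_, ?_⟩
  · rw [← he, e.apply_symm_apply]
  · rw [Set.image_image]
    simp

theorem Iso.trans {L : Submodule ℤ V} {P : Set V} {L₁ : Submodule ℤ V₁} {P₁ : Set V₁}
    {L₂ : Submodule ℤ V₂} {P₂ : Set V₂} (h : Iso L P L₁ P₁) (h' : Iso L₁ P₁ L₂ P₂) :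
    Iso L P L₂ P₂ := by
  obtain ⟨e, he, rfl⟩ := h
  obtain ⟨e', he', rfl⟩ := h'
  refine ⟨e.trans e', fun x => ?_, ?_⟩
  · rw [LinearEquiv.trans_apply, he', he]
  · rw [Set.image_image]
    rfl

/-- `conv (P₁ ⊕ {0}, {0} ⊕ P₂)`. -/
def freeSum (P₁ : Set V₁) (P₂ : Set V₂) : Set (V₁ × V₂) :=
  convexHull ℝ ((fun x => (x, (0 : V₂))) '' P₁ ∪ (fun y => ((0 : V₁), y)) '' P₂)

/-- `P` splits into the factors `P₁` and `P₂`, with respect to the lattices `L`, `L₁`, `L₂`. -/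
def Splits (L : Submodule ℤ V) (P : Set V) (L₁ : Submodule ℤ V₁) (P₁ : Set V₁)
    (L₂ : Submodule ℤ V₂) (P₂ : Set V₂) : Prop :=
  Iso L P (L₁.prod L₂) (freeSum P₁ P₂)

/-- `P` is 1-irreducible if it does not split into `[-1,1]` (with lattice `ℤ`) and some Fano
polytope `Q`. Up to isomorphism the lattice of `Q` is `ℤ^k`. The zero polytope is allowed for `Q`,
so that `[-1,1]` itself is not 1-irreducible. -/
def IsOneIrreducible (L : Submodule ℤ V) (P : Set V) : Prop :=
  ∀ (k : ℕ) (Q : Set (Fin k → ℝ)), IsFano (stdLattice k) Q →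
    ¬ Splits L P intLattice (Set.Icc (-1 : ℝ) 1) (stdLattice k) Q

/-- The iterated free sum of `r` copies of `[-1,1]`, in `ℝ^r`: the convex hull of the union of the
copies of `[-1,1]` on the coordinate axes (and `{0}` if `r = 0`). -/
def intervals (r : ℕ) : Set (Fin r → ℝ) :=
  convexHull ℝ ({0} ∪ ⋃ i : Fin r, (fun t : ℝ => Pi.single i t) '' Set.Icc (-1 : ℝ) 1)

/-- `P` splits into `P'` and `r` copies of `[-1,1]`. -/
def SplitsWithIntervals (L : Submodule ℤ V) (P : Set V) (L' : Submodule ℤ V₁) (P' : Set V₁)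
    (r : ℕ) : Prop :=
  Splits L P L' P' (stdLattice r) (intervals r)

/-- The reflexive cs-crosspolytopes with respect to the lattice `L`. -/
def ReflexiveCross (L : Submodule ℤ V) : Type _ :=
  {P : Set V // IsReflexivePolytope L P ∧ IsCSCrosspolytope P}

/-- Isomorphism of reflexive cs-crosspolytopes with respect to the same lattice. -/
def crossSetoid (L : Submodule ℤ V) : Setoid (ReflexiveCross L) where
  r P Q := Iso L P.1 L Q.1
  iseqv := ⟨fun P => Iso.refl L P.1, fun h => h.symm, fun h h' => h.trans h'⟩

end Isomorphism

/-! ### Wirth matrices -/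

section WirthMatrices

variable {d : ℕ}

/-- The block matrix with blocks `2 id_f`, `0` (first row of blocks) and `C`, `id_g` (second). -/
def blockMatrix {f g : ℕ} (h : f + g = d) (C : Matrix (Fin g) (Fin f) ℤ) :
    Matrix (Fin d) (Fin d) ℤ :=
  Matrix.reindex (finSumFinEquiv.trans (finCongr h)) (finSumFinEquiv.trans (finCongr h))
    (Matrix.fromBlocks ((2 : ℤ) • (1 : Matrix (Fin f) (Fin f) ℤ)) 0 C 1)

/-- The condition on the block `C`: entries in `{0,1}`, an odd number of ones in each column. -/
def IsAdmissibleBlock {f g : ℕ} (C : Matrix (Fin g) (Fin f) ℤ) : Prop :=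
  (∀ i j, C i j = 0 ∨ C i j = 1) ∧
    ∀ j, Odd (Finset.univ.filter (fun i => C i j = 1)).card

/-- Wirth matrices of size `d`; the empty matrix is admitted for `d = 0`. -/
def IsWirth (A : Matrix (Fin d) (Fin d) ℤ) : Prop :=
  ∃ (f g : ℕ) (h : f + g = d) (C : Matrix (Fin g) (Fin f) ℤ),
    (f < d ∨ d = 0) ∧ IsAdmissibleBlock C ∧ A = blockMatrix h C

/-- 1-minimal Wirth matrices: each row of `C` contains some `1`. -/
def IsOneMinimalWirth (A : Matrix (Fin d) (Fin d) ℤ) : Prop :=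
  ∃ (f g : ℕ) (h : f + g = d) (C : Matrix (Fin g) (Fin f) ℤ),
    (f < d ∨ d = 0) ∧ IsAdmissibleBlock C ∧ A = blockMatrix h C ∧ ∀ i, ∃ j, C i j = 1

/-- The rows of `A` that contain exactly one `1`. -/
def singleOneRows (A : Matrix (Fin d) (Fin d) ℤ) : Finset (Fin d) :=
  Finset.univ.filter (fun i => (Finset.univ.filter (fun j => A i j = 1)).card = 1)

/-- The reduction of `A`: delete the rows with exactly one `1` and the columns of the same indices
(the remaining indices keep their order). -/
def reduction (A : Matrix (Fin d) (Fin d) ℤ) :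
    Matrix (Fin (singleOneRows A)ᶜ.card) (Fin (singleOneRows A)ᶜ.card) ℤ :=
  A.submatrix ((singleOneRows A)ᶜ.orderEmbOfFin rfl) ((singleOneRows A)ᶜ.orderEmbOfFin rfl)

/-- The polytope in `ℝ^n` (with lattice `ℤ^n`) that is defined by the reduction of `A`. -/
def reductionPolytope (A : Matrix (Fin d) (Fin d) ℤ) :
    Set (Fin (singleOneRows A)ᶜ.card → ℝ) :=
  matrixPolytope (Pi.basisFun ℝ _) (reduction A)

/-- Equivalence of matrices: up to a permutation of the columns and left multiplication by an
element of `GL_d(ℤ)`. -/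
def MatEquiv (A B : Matrix (Fin d) (Fin d) ℤ) : Prop :=
  ∃ (U : GL (Fin d) ℤ) (σ : Equiv.Perm (Fin d)),
    B = (U : Matrix (Fin d) (Fin d) ℤ) * A.submatrix id σ

theorem MatEquiv.refl (A : Matrix (Fin d) (Fin d) ℤ) : MatEquiv A A :=
  ⟨1, 1, by ext i j; simp⟩

theorem MatEquiv.symm {A B : Matrix (Fin d) (Fin d) ℤ} (h : MatEquiv A B) : MatEquiv B A := by
  obtain ⟨U, σ, rfl⟩ := h
  refine ⟨U⁻¹, σ⁻¹, ?_⟩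
  have h1 : ((U : Matrix (Fin d) (Fin d) ℤ) * A.submatrix id σ).submatrix id (σ⁻¹ : Equiv.Perm _)
      = (U : Matrix (Fin d) (Fin d) ℤ) * A := by
    ext i j
    simp [Matrix.mul_apply]
  rw [h1, ← Matrix.mul_assoc, ← Units.val_mul]
  simp

theorem MatEquiv.trans {A B C : Matrix (Fin d) (Fin d) ℤ} (h : MatEquiv A B)
    (h' : MatEquiv B C) : MatEquiv A C := by
  obtain ⟨U, σ, rfl⟩ := h
  obtain ⟨U', σ', rfl⟩ := h'
  refine ⟨U' * U, σ * σ', ?_⟩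
  have h1 : ((U : Matrix (Fin d) (Fin d) ℤ) * A.submatrix id σ).submatrix id σ'
      = (U : Matrix (Fin d) (Fin d) ℤ) * A.submatrix id (σ * σ') := by
    ext i j
    simp [Matrix.mul_apply]
  rw [h1, Units.val_mul, Matrix.mul_assoc]

/-- The type of Wirth matrices of size `d`. -/
def WirthMatrix (d : ℕ) : Type := {A : Matrix (Fin d) (Fin d) ℤ // IsWirth A}

/-- Equivalence of Wirth matrices. -/
def wirthSetoid (d : ℕ) : Setoid (WirthMatrix d) where
  r A B := MatEquiv A.1 B.1
  iseqv := ⟨fun A => MatEquiv.refl A.1, fun h => h.symm, fun h h' => h.trans h'⟩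

end WirthMatrices

end CSCross

end

open CSCross

/-! Write the crosspolytope as the hull of ±e_i for a real basis e, and let x_i denote coordinates
with respect to e. The polytope is the ℓ¹ unit ball of e, and its dual is the cube whose vertices
are the forms e_i ↦ ±1. Hence reflexivity says that the e_i lie in L and that every signed sum Σ
±x_i is integral on L. Comparing sign vectors that differ in one place, this amounts to 2x_i ∈ ℤ and
Σ x_i ∈ ℤ on L, which is `EvenFrame`. So L / ⊕ℤe_i is a binary linear code in (½ℤ/ℤ)^d with words of
even weight, and the theorem becomes linear algebra over the field with two elements.

A Wirth matrix is a systematic generator matrix of this code. Take a maximal set J of coordinates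
for which L contains vectors c_j, j ∈ J, with coordinates ½δ_jk on J, and reduce their other
coordinates to 0 or -1/2. The c_j together with the e_i, i ∉ J, form a lattice basis, in which e_j =
2c_j + Σ C_ij e_i; even weight of the word c_j means an odd number of ones in the column of C. This
is `EvenFrame.exists_isWirthBlock`, with converse `evenFrame_columnBasis`.

An isomorphism of crosspolytopes permutes the axes up to sign (`exists_equiv_of_image_crossHull`).
Flipping the sign of an axis moves the image of x by 2x_i times a frame vector, hence by a lattice
vector, so the signs can be dropped (`EvenFrame.exists_equiv_of_iso`). What remains is a column
permutation and a change of lattice basis, that is, matrix equivalence. A facet picks one vertex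
from each antipodal pair, which is again a frame of the same polytope (`exists_basis_of_isFacet`).

A factor [-1,1] corresponds to a coordinate that is integral on L, that is, to a position where all
code words vanish and to a row of A whose only nonzero entry is a diagonal 1
(`isIntegralCoord_columnBasis`, `EvenFrame.exists_isIntegralCoord_of_splits`). The sign-free
permutation preserves integral coordinates, which makes the splitting unique
(`EvenFrame.unique_splitting`). -/

noncomputable section

namespace CSCross

open Module

/-! ### Crosspolytopes as ℓ¹ balls: vertices, free sums, linear isomorphisms. -/

section CrossHull

variable {V : Type*} [NormedAddCommGroup V] [NormedSpace ℝ V]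
variable {V' : Type*} [NormedAddCommGroup V'] [NormedSpace ℝ V']
variable {ι κ : Type*}

theorem mem_crossHull_self (v : ι → V) (i : ι) : v i ∈ crossHull v :=
  subset_convexHull _ _ (Or.inl (Or.inr ⟨i, rfl⟩))

theorem neg_mem_crossHull_self (v : ι → V) (i : ι) : -v i ∈ crossHull v :=
  subset_convexHull _ _ (Or.inr ⟨i, rfl⟩)

theorem zero_mem_crossHull (v : ι → V) : (0 : V) ∈ crossHull v :=
  subset_convexHull _ _ (Or.inl (Or.inl rfl))

theorem image_crossHull (f : V →ₗ[ℝ] V') (v : ι → V) :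
    f '' crossHull v = crossHull (fun i => f (v i)) := by
  unfold crossHull
  rw [f.image_convexHull, Set.image_union, Set.image_union, ← Set.range_comp, ← Set.range_comp]
  simp [Function.comp_def]

theorem crossHull_reindex (v : ι → V) (σ : κ ≃ ι) :
    crossHull (fun k => v (σ k)) = crossHull v := by
  unfold crossHull
  rw [show (fun k => v (σ k)) = v ∘ σ from rfl, σ.surjective.range_comp,
    show (fun k => -(v ∘ σ) k) = (fun i => -v i) ∘ σ from rfl, σ.surjective.range_comp]

theorem crossHull_sign (v w : ι → V) (h : ∀ i, w i = v i ∨ w i = -v i) :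
    crossHull w = crossHull v := by
  unfold crossHull
  congr 1
  ext x
  simp only [Set.mem_union, Set.mem_singleton_iff, Set.mem_range]
  constructor
  · rintro ((h0 | ⟨i, rfl⟩) | ⟨i, rfl⟩)
    · exact Or.inl (Or.inl h0)
    · rcases h i with h | h <;> rw [h]
      exacts [Or.inl (Or.inr ⟨i, rfl⟩), Or.inr ⟨i, rfl⟩]
    · rcases h i with h | h <;> rw [h]
      exacts [Or.inr ⟨i, rfl⟩, Or.inl (Or.inr ⟨i, by simp⟩)]
  · rintro ((h0 | ⟨i, rfl⟩) | ⟨i, rfl⟩)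
    · exact Or.inl (Or.inl h0)
    · rcases h i with h | h
      exacts [Or.inl (Or.inr ⟨i, h⟩), Or.inr ⟨i, by simp [h]⟩]
    · rcases h i with h | h
      exacts [Or.inr ⟨i, by simp [h]⟩, Or.inl (Or.inr ⟨i, h⟩)]

theorem extremePoints_crossHull_subset (v : ι → V) {x : V}
    (hx : x ∈ (crossHull v).extremePoints ℝ) : x = 0 ∨ ∃ i, x = v i ∨ x = -v i := by
  rcases extremePoints_convexHull_subset hx with (h | ⟨i, rfl⟩) | ⟨i, rfl⟩
  · exact Or.inl h
  · exact Or.inr ⟨i, Or.inl rfl⟩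
  · exact Or.inr ⟨i, Or.inr rfl⟩

/-- The free sum of two crosspolytopes is a crosspolytope. -/
theorem freeSum_crossHull (v : ι → V) (w : κ → V') :
    freeSum (crossHull v) (crossHull w) =
      crossHull (Sum.elim (fun i => (v i, (0 : V'))) (fun k => ((0 : V), w k))) := by
  have h1 : (fun x : V => (x, (0 : V'))) '' crossHull v = crossHull (fun i => (v i, (0 : V'))) :=
    image_crossHull (LinearMap.inl ℝ V V') v
  have h2 : (fun y : V' => ((0 : V), y)) '' crossHull w = crossHull (fun k => ((0 : V), w k)) :=
    image_crossHull (LinearMap.inr ℝ V V') w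
  unfold freeSum
  rw [h1, h2]
  unfold crossHull
  rw [convexHull_convexHull_union_left, convexHull_convexHull_union_right]
  congr 1
  ext x
  simp only [Set.mem_union, Set.mem_singleton_iff, Set.mem_range, Sum.exists, Sum.elim_inl,
    Sum.elim_inr]
  tauto

theorem Icc_eq_crossHull : Set.Icc (-1 : ℝ) 1 = crossHull (fun _ : Unit => (1 : ℝ)) := by
  apply Set.Subset.antisymm
  · rw [← segment_eq_Icc (by norm_num)]
    exact (convex_convexHull ℝ _).segment_subset (neg_mem_crossHull_self _ ())
      (mem_crossHull_self _ ())
  · refine convexHull_min ?_ (convex_Icc _ _)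
    rintro x ((h | ⟨i, rfl⟩) | ⟨i, rfl⟩)
    · rw [Set.mem_singleton_iff.1 h]; norm_num
    · norm_num
    · norm_num

theorem intervals_eq_crossHull (r : ℕ) : intervals r = crossHull (Pi.basisFun ℝ (Fin r)) := by
  apply Set.Subset.antisymm
  · refine convexHull_min ?_ (convex_convexHull ℝ _)
    rintro x (h | h)
    · rw [Set.mem_singleton_iff.1 h]; exact zero_mem_crossHull _
    · obtain ⟨i, t, ht, rfl⟩ := Set.mem_iUnion.1 h
      have h1 : (LinearMap.single ℝ (fun _ : Fin r => ℝ) i) '' (crossHull (fun _ : Unit => (1 : ℝ)))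
          ⊆ crossHull (Pi.basisFun ℝ (Fin r)) := by
        rw [image_crossHull]
        refine convexHull_min ?_ (convex_convexHull ℝ _)
        rintro x ((h | ⟨_, rfl⟩) | ⟨_, rfl⟩)
        · rw [Set.mem_singleton_iff.1 h]; exact zero_mem_crossHull _
        · simpa using mem_crossHull_self (Pi.basisFun ℝ (Fin r)) i
        · simpa using neg_mem_crossHull_self (Pi.basisFun ℝ (Fin r)) i
      exact h1 ⟨t, Icc_eq_crossHull ▸ ht, rfl⟩
  · refine convexHull_mono ?_
    rintro x ((h | ⟨i, rfl⟩) | ⟨i, rfl⟩)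
    · exact Or.inl h
    · exact Or.inr (Set.mem_iUnion.2 ⟨i, 1, by norm_num, by simp⟩)
    · exact Or.inr (Set.mem_iUnion.2 ⟨i, -1, by norm_num, by simp [Pi.single_neg]⟩)

variable [Fintype ι]

/-- A crosspolytope is a unit ball of an `ℓ¹`-norm. -/
theorem mem_crossHull (e : Basis ι ℝ V) (x : V) :
    x ∈ crossHull e ↔ ∑ i, |e.repr x i| ≤ 1 := by
  constructor
  · intro hx
    have hc : Convex ℝ {x : V | ∑ i, |e.repr x i| ≤ 1} := by
      intro x hx y hy a b ha hb hab
      simp only [Set.mem_ofPred_eq] at *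
      calc ∑ i, |e.repr (a • x + b • y) i|
          ≤ ∑ i, (a * |e.repr x i| + b * |e.repr y i|) := by
            refine Finset.sum_le_sum fun i _ => ?_
            simp only [map_add, map_smul, Finsupp.add_apply, Finsupp.smul_apply, smul_eq_mul]
            refine (abs_add_le _ _).trans ?_
            rw [abs_mul, abs_mul, abs_of_nonneg ha, abs_of_nonneg hb]
        _ = a * ∑ i, |e.repr x i| + b * ∑ i, |e.repr y i| := by
            rw [Finset.sum_add_distrib, Finset.mul_sum, Finset.mul_sum]
        _ ≤ 1 := by nlinarith
    refine convexHull_min ?_ hc hx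
    classical
    have h1 : ∀ i, ∑ j, |e.repr (e i) j| = 1 := fun i => by
      simp [Finsupp.single_apply, apply_ite abs]
    rintro x ((h | ⟨i, rfl⟩) | ⟨i, rfl⟩)
    · rw [Set.mem_singleton_iff.1 h]; simp
    · exact (h1 i).le
    · simpa using (h1 i).le
  · intro hx
    -- The extra index `none` puts the unused mass 1 - Σ|x_i| at the point 0; every other weight
    -- sits at the vertex with the sign of its coordinate.
    set w : Option ι → ℝ := fun o => o.elim (1 - ∑ i, |e.repr x i|) (fun i => |e.repr x i|)
      with hw
    set z : Option ι → V := fun o => o.elim 0 (fun i => if 0 ≤ e.repr x i then e i else -e i)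
      with hz
    have h1 : ∑ o, w o • z o ∈ crossHull e := by
      refine (convex_convexHull ℝ _).sum_mem ?_ ?_ ?_
      · rintro (_ | i) _
        · simpa [hw] using hx
        · simp [hw]
      · simp [hw, Fintype.sum_option]
      · rintro (_ | i) _
        · exact zero_mem_crossHull _
        · simp only [hz, Option.elim_some]
          split_ifs
          · exact mem_crossHull_self _ i
          · exact neg_mem_crossHull_self _ i
    have h2 : ∑ o, w o • z o = x := by
      rw [Fintype.sum_option]
      conv_rhs => rw [← e.sum_repr x]
      simp only [hw, hz, Option.elim_none, Option.elim_some, smul_zero, zero_add]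
      refine Finset.sum_congr rfl fun i _ => ?_
      split_ifs with h
      · rw [abs_of_nonneg h]
      · rw [abs_of_neg (not_le.1 h), smul_neg, neg_smul, neg_neg]
    rwa [h2] at h1

/-- The i-th coordinate is at most 1 on the ball, so it equals 1 at both ends of a segment through
e_i; the ℓ¹ bound then leaves nothing for the other coordinates. -/
theorem basis_mem_extremePoints (e : Basis ι ℝ V) (i : ι) :
    e i ∈ (crossHull e).extremePoints ℝ := by
  classical
  refine ⟨mem_crossHull_self _ i, fun x hx y hy hxy => ?_⟩
  obtain ⟨a, b, ha, hb, hab, h⟩ := hxy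
  rw [mem_crossHull] at hx hy
  have h1 : a * e.repr x i + b * e.repr y i = 1 := by
    have := congrArg (fun z => e.repr z i) h
    simpa using this
  have hle : ∀ z : V, |e.repr z i| ≤ ∑ j, |e.repr z j| := fun z =>
    Finset.single_le_sum (f := fun j => |e.repr z j|) (fun j _ => abs_nonneg _)
      (Finset.mem_univ i)
  have hx1 : e.repr x i ≤ 1 := (le_abs_self _).trans ((hle x).trans hx)
  have hy1 : e.repr y i ≤ 1 := (le_abs_self _).trans ((hle y).trans hy)
  have hxi : e.repr x i = 1 := by
    apply le_antisymm hx1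
    by_contra hlt
    nlinarith
  have hxj : ∀ j, j ≠ i → e.repr x j = 0 := by
    intro j hj
    have h2 : |e.repr x i| + |e.repr x j| ≤ ∑ j, |e.repr x j| := by
      rw [← Finset.sum_pair (f := fun j => |e.repr x j|) hj.symm]
      exact Finset.sum_le_univ_sum_of_nonneg fun _ => abs_nonneg _
    rw [hxi, abs_one] at h2
    have : |e.repr x j| ≤ 0 := by linarith
    exact abs_nonpos_iff.1 this
  refine e.ext_elem fun j => ?_
  by_cases hj : j = i
  · subst hj; simp [hxi]
  · rw [hxj j hj]; simp [Ne.symm hj]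

theorem neg_basis_mem_extremePoints (e : Basis ι ℝ V) (i : ι) :
    -e i ∈ (crossHull e).extremePoints ℝ := by
  have h := image_extremePoints (LinearEquiv.neg ℝ (M := V)) (crossHull e)
  have h2 : (LinearEquiv.neg ℝ (M := V)) '' crossHull e = crossHull e := by
    have := image_crossHull (LinearEquiv.neg ℝ (M := V)).toLinearMap e
    refine (Eq.trans ?_ this).trans (crossHull_sign _ _ fun i => Or.inr (by simp))
    rfl
  rw [h2] at h
  rw [← h]
  exact ⟨e i, basis_mem_extremePoints e i, by simp⟩

theorem zero_mem_interior_crossHull (e : Basis ι ℝ V) : (0 : V) ∈ interior (crossHull e) := by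
  have : FiniteDimensional ℝ V := e.finiteDimensional_of_finite
  rw [mem_interior]
  refine ⟨{x | ∑ i, |e.repr x i| < 1}, fun x hx => (mem_crossHull e x).2 (le_of_lt hx), ?_, ?_⟩
  · refine isOpen_lt ?_ continuous_const
    refine continuous_finsetSum _ fun i _ => ?_
    exact (LinearMap.continuous_of_finiteDimensional (e.coord i)).abs
  · simp

/-- A linear isomorphism of crosspolytopes permutes the axes, up to signs. -/
theorem exists_equiv_of_image_crossHull [Fintype κ] (e : Basis ι ℝ V) (e' : Basis κ ℝ V')
    (g : V ≃ₗ[ℝ] V') (h : g '' crossHull e = crossHull e') :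
    ∃ σ : ι ≃ κ, ∀ i, g (e i) = e' (σ i) ∨ g (e i) = -e' (σ i) := by
  have h1 : ∀ i, ∃ k, g (e i) = e' k ∨ g (e i) = -e' k := by
    intro i
    have h2 : g (e i) ∈ (crossHull e').extremePoints ℝ := by
      rw [← h, ← image_extremePoints]
      exact ⟨_, basis_mem_extremePoints e i, rfl⟩
    rcases extremePoints_crossHull_subset _ h2 with h3 | h3
    · exact absurd ((LinearEquiv.map_eq_zero_iff g).1 h3) (e.ne_zero i)
    · exact h3
  choose s hs using h1
  have hinj : Function.Injective s := by
    classical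
    intro i j hij
    by_contra hne
    -- Two frame vectors sent to the same axis would have images equal up to sign, against
    -- independence.
    have h4 : g (e i) = g (e j) ∨ g (e i) = g (-e j) := by
      rw [map_neg]
      rcases hs i with h | h <;> rcases hs j with h' | h' <;> rw [h, h', hij] <;> simp
    rcases h4 with h4 | h4
    · exact hne (e.injective (g.injective h4))
    · have := congrArg (fun z => e.repr z i) (g.injective h4)
      simp [Ne.symm hne] at this
  have hcard : Fintype.card ι = Fintype.card κ := by
    rw [← finrank_eq_card_basis e, ← finrank_eq_card_basis e', g.finrank_eq]
  exact ⟨Equiv.ofBijective s ((Fintype.bijective_iff_injective_and_card s).2 ⟨hinj, hcard⟩), hs⟩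

end CrossHull

/-! ### Reflexivity as a parity condition on coordinates. -/

section Reflexive

variable {V : Type*} [NormedAddCommGroup V] [NormedSpace ℝ V] {ι : Type*}

/-- The frame `e` of the lattice `L` has integral members, and the elements of `L` have half-integral
coordinates with integral sum. -/
structure EvenFrame [Fintype ι] (L : Submodule ℤ V) (e : Basis ι ℝ V) : Prop where
  mem : ∀ i, e i ∈ L
  two_mul : ∀ x ∈ L, ∀ i, ∃ n : ℤ, 2 * e.repr x i = n
  sum : ∀ x ∈ L, ∃ n : ℤ, ∑ i, e.repr x i = n

theorem dualPolytope_crossHull (e : Basis ι ℝ V) :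
    dualPolytope (crossHull e) = {u | ∀ i, u (e i) ∈ Set.Icc (-1 : ℝ) 1} := by
  ext u
  constructor
  · intro hu i
    have h1 := hu _ (mem_crossHull_self e i)
    have h2 := hu _ (neg_mem_crossHull_self e i)
    rw [map_neg] at h2
    exact ⟨h1, by linarith⟩
  · intro hu y hy
    have hc : Convex ℝ {y : V | -1 ≤ u y} := convex_halfSpace_ge u.isLinear _
    refine convexHull_min ?_ hc hy
    rintro x ((h | ⟨i, rfl⟩) | ⟨i, rfl⟩)
    · rw [Set.mem_singleton_iff.1 h]; simp
    · exact (hu i).1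
    · have := (hu i).2
      simp only [Set.mem_ofPred_eq, map_neg]
      linarith

/-- These are the corners of the dual cube; as extreme points they belong to every set that
generates it, which is how integrality of the dual is exploited. -/
theorem constr_mem_extremePoints [Finite ι] (e : Basis ι ℝ V) (s : ι → ℝ) (hs : ∀ i, s i = 1 ∨ s i = -1) :
    e.constr ℝ s ∈ (dualPolytope (crossHull e)).extremePoints ℝ := by
  rw [dualPolytope_crossHull]
  refine ⟨fun i => ?_, fun x hx y hy hxy => ?_⟩
  · rw [e.constr_basis]
    rcases hs i with h | h <;> rw [h] <;> norm_num
  · obtain ⟨a, b, ha, hb, hab, h⟩ := hxy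
    refine e.ext fun i => ?_
    have h1 := congrArg (fun z : Dual ℝ V => z (e i)) h
    simp only [LinearMap.add_apply, LinearMap.smul_apply, smul_eq_mul, e.constr_basis] at h1 ⊢
    have hx1 := hx i
    have hy1 := hy i
    rcases hs i with h2 | h2 <;> rw [h2] at h1 ⊢
    · apply le_antisymm hx1.2
      by_contra hlt
      nlinarith [hy1.2]
    · apply le_antisymm _ hx1.1
      by_contra hlt
      nlinarith [hy1.1]

variable [Fintype ι]

theorem dualPolytope_eq_convexHull (e : Basis ι ℝ V) :
    dualPolytope (crossHull e) =
      convexHull ℝ ((e.constr ℝ (M' := ℝ)) '' (Set.univ.pi fun _ => {-1, 1})) := by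
  have h1 := (e.constr ℝ (M' := ℝ)).toLinearMap.image_convexHull
    (Set.univ.pi fun _ : ι => ({-1, 1} : Set ℝ))
  refine Eq.trans ?_ h1
  rw [convexHull_pi, convexHull_pair, segment_eq_Icc (by norm_num), dualPolytope_crossHull]
  ext u
  constructor
  · intro hu
    refine ⟨fun i => u (e i), fun i _ => hu i, ?_⟩
    exact e.ext fun i => e.constr_basis ℝ _ i
  · rintro ⟨s, hs, rfl⟩ i
    have h2 := hs i (Set.mem_univ i)
    have h3 := e.constr_basis ℝ s i
    exact h3.symm ▸ h2

/-- The signed sum equals Σ x_i minus the sum of 2x_i over the negative signs, and both are integers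
on L. -/
theorem constr_mem_dualLattice {L : Submodule ℤ V} {e : Basis ι ℝ V} (h : EvenFrame L e)
    (s : ι → ℝ) (hs : ∀ i, s i = 1 ∨ s i = -1) : e.constr ℝ s ∈ dualLattice L := by
  intro x hx
  obtain ⟨n, hn⟩ := h.sum x hx
  choose m hm using h.two_mul x hx
  refine ⟨n - ∑ i, if s i = 1 then 0 else m i, ?_⟩
  rw [e.constr_apply_fintype ℝ]
  push_cast
  rw [← hn, ← Finset.sum_sub_distrib]
  refine Finset.sum_congr rfl fun i _ => ?_
  rcases hs i with h | h
  · simp [h]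
  · have : ¬ ((-1 : ℝ) = 1) := by norm_num
    simp only [h, this, if_false, ← hm, smul_eq_mul, e.equivFun_apply]
    ring

/-- The coordinate sum is integral on L and takes the value ±1 at ±e_i, so a multiplier k would
divide 1. -/
theorem EvenFrame.primitive {L : Submodule ℤ V} {e : Basis ι ℝ V} (h : EvenFrame L e)
    {v : V} (hv : v ∈ (crossHull e).extremePoints ℝ) : IsPrimitivePoint L v := by
  classical
  have key : ∀ c : ℝ, (c = 1 ∨ c = -1) → ∀ i, IsPrimitivePoint L (c • e i) := by
    intro c hc i
    refine ⟨?_, fun w hw k hk => ?_⟩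
    · rcases hc with rfl | rfl
      · simpa using h.mem i
      · simpa using h.mem i
    · obtain ⟨n, hn⟩ := h.sum w hw
      have h1 : c = k * n := by
        have := congrArg (fun z => ∑ j, e.repr z j) hk
        simp only [map_smul, map_nsmul, Finsupp.smul_apply, e.repr_self, Finsupp.single_apply,
          smul_eq_mul, nsmul_eq_mul, ← Finset.mul_sum, hn] at this
        simpa using this
      have h2 : (k : ℤ) ∣ 1 := by
        rcases hc with rfl | rfl
        · exact ⟨n, by exact_mod_cast h1⟩
        · exact ⟨-n, by rw [mul_neg]; have : (-1 : ℤ) = k * n := by exact_mod_cast h1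
                        omega⟩
      have h3 : k = 1 := by
        have := Int.natCast_dvd_natCast.1 (by exact_mod_cast h2 : (k : ℤ) ∣ ((1 : ℕ) : ℤ))
        exact Nat.dvd_one.1 this
      rw [hk, h3, one_smul]
  rcases extremePoints_crossHull_subset _ hv with rfl | ⟨i, rfl | rfl⟩
  · have : IsEmpty ι := by
      by_contra hne
      obtain ⟨i⟩ := not_isEmpty_iff.1 hne
      have h1 := hv.2 (mem_crossHull_self e i) (neg_mem_crossHull_self e i)
        ⟨1 / 2, 1 / 2, by norm_num, by norm_num, by norm_num, by simp⟩
      exact e.ne_zero i h1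
    exact ⟨L.zero_mem, fun w _ k _ => e.ext_elem fun i => isEmptyElim i⟩
  · simpa using key 1 (Or.inl rfl) i
  · simpa using key (-1) (Or.inr rfl) i

theorem EvenFrame.isReflexive {L : Submodule ℤ V} {e : Basis ι ℝ V} (h : EvenFrame L e) :
    IsReflexivePolytope L (crossHull e) := by
  classical
  refine ⟨⟨?_, zero_mem_interior_crossHull e, fun v hv => h.primitive hv⟩, ?_⟩
  · refine ⟨{0} ∪ Finset.univ.image e ∪ Finset.univ.image (fun i => -e i), ?_, ?_⟩
    · intro x hx
      simp only [Finset.coe_union, Finset.coe_singleton, Finset.coe_image, Finset.coe_univ,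
        Set.image_univ] at hx
      rcases hx with (hx | ⟨i, rfl⟩) | ⟨i, rfl⟩
      · rw [Set.mem_singleton_iff.1 hx]; exact L.zero_mem
      · exact h.mem i
      · exact L.neg_mem (h.mem i)
    · simp [crossHull, Set.insert_union]
  · have hfin : ((e.constr ℝ (M' := ℝ)) '' (Set.univ.pi fun _ : ι => ({-1, 1} : Set ℝ))).Finite :=
      (Set.Finite.pi' fun _ => Set.toFinite _).subset (by intro x hx i; exact hx i trivial)
        |>.image _
    refine ⟨hfin.toFinset, ?_, ?_⟩
    · rw [hfin.coe_toFinset]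
      rintro _ ⟨s, hs, rfl⟩
      refine constr_mem_dualLattice h s fun i => ?_
      rcases hs i trivial with h | h
      · exact Or.inr h
      · exact Or.inl h
    · rw [hfin.coe_toFinset, dualPolytope_eq_convexHull]

/-- The all-ones corner of the dual gives integrality of Σ x_i; subtracting the corner with one
flipped sign leaves 2x_i. -/
theorem evenFrame_of_isReflexive {L : Submodule ℤ V} {e : Basis ι ℝ V}
    (h : IsReflexivePolytope L (crossHull e)) : EvenFrame L e := by
  classical
  obtain ⟨⟨-, -, hprim⟩, S, hS, hSeq⟩ := h
  have hdual : ∀ s : ι → ℝ, (∀ i, s i = 1 ∨ s i = -1) → ∀ x ∈ L, ∃ n : ℤ,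
      ∑ i, e.repr x i * s i = n := by
    intro s hs x hx
    have h1 := constr_mem_extremePoints e s hs
    rw [hSeq] at h1
    have h2 := hS (extremePoints_convexHull_subset h1) x hx
    simpa [e.constr_apply_fintype ℝ] using h2
  have hsum : ∀ x ∈ L, ∃ n : ℤ, ∑ i, e.repr x i = n := by
    intro x hx
    simpa using hdual (fun _ => 1) (fun _ => Or.inl rfl) x hx
  refine ⟨fun i => (hprim _ (basis_mem_extremePoints e i)).1, fun x hx i => ?_, hsum⟩
  obtain ⟨n, hn⟩ := hsum x hx
  obtain ⟨m, hm⟩ := hdual (fun j => if j = i then -1 else 1)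
    (fun j => by by_cases h : j = i <;> simp [h]) x hx
  refine ⟨n - m, ?_⟩
  push_cast
  rw [← hn, ← hm, ← Finset.sum_sub_distrib, Finset.sum_eq_single i]
  · simp; ring
  · intro j _ hj; simp [hj]
  · simp

end Reflexive

/-! ### Integrality of coordinates. -/

section Span

variable {V : Type*} [NormedAddCommGroup V] [NormedSpace ℝ V] {ι : Type*}

theorem mem_span_basis_iff (b : Basis ι ℝ V) (x : V) :
    x ∈ Submodule.span ℤ (Set.range b) ↔ ∀ i, ∃ n : ℤ, b.repr x i = n := by
  rw [b.mem_span_iff_repr_mem ℤ]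
  simp [Set.mem_range, eq_comm]

/-- The `i`-th coordinate with respect to the frame `e` is integral on `L`. -/
def IsIntegralCoord (L : Submodule ℤ V) (e : Basis ι ℝ V) (i : ι) : Prop :=
  ∀ x ∈ L, ∃ n : ℤ, e.repr x i = n

end Span

/-! ### Wirth matrices over an arbitrary index type and the frame of their columns. -/

section Blocks

variable {V : Type*} [NormedAddCommGroup V] [NormedSpace ℝ V]
variable {V' : Type*} [NormedAddCommGroup V'] [NormedSpace ℝ V']
variable {ι κ : Type*} [Fintype ι] [Fintype κ]

/-- The vectors with the columns of `A` as coordinates. -/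
def columnVectors (b : ι → V) (A : Matrix ι κ ℤ) (j : κ) : V := ∑ i, A i j • b i

theorem matrixPolytope_eq {n : ℕ} (b : Fin n → V) (A : Matrix (Fin n) (Fin n) ℤ) :
    matrixPolytope b A = crossHull (columnVectors b A) := rfl

/-- The shape of a Wirth matrix, for an arbitrary index type: `p` holds for the indices of the block
`2 id`. -/
structure IsWirthBlock (p : ι → Prop) (A : Matrix ι ι ℤ) : Prop where
  diag_two : ∀ i, p i → A i i = 2
  diag_one : ∀ i, ¬ p i → A i i = 1
  row_zero : ∀ i j, i ≠ j → p i → A i j = 0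
  col_zero : ∀ i j, i ≠ j → ¬ p j → A i j = 0
  zero_or_one : ∀ i j, i ≠ j → A i j = 0 ∨ A i j = 1
  odd : ∀ j, Odd (∑ i, A i j)

/-- The rows with exactly one entry `1`, in a Wirth matrix. -/
def IsUnitRow (p : ι → Prop) (A : Matrix ι ι ℤ) (i : ι) : Prop :=
  ¬ p i ∧ ∀ j, j ≠ i → A i j = 0

/-- A deleted unit row vanishes on the columns that are kept, so column sums and their parity do not
change. -/
theorem IsWirthBlock.submatrix {p : ι → Prop} {A : Matrix ι ι ℤ} (h : IsWirthBlock p A)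
    (φ : κ ↪ ι) (hφ : ∀ i, i ∉ Set.range φ → IsUnitRow p A i) :
    IsWirthBlock (fun k => p (φ k)) (A.submatrix φ φ) := by
  classical
  refine ⟨fun i => h.diag_two _, fun i => h.diag_one _,
    fun i j hij => h.row_zero _ _ (φ.injective.ne hij),
    fun i j hij => h.col_zero _ _ (φ.injective.ne hij),
    fun i j hij => h.zero_or_one _ _ (φ.injective.ne hij), fun j => ?_⟩
  have h1 : ∑ i, A i (φ j) = ∑ k, A (φ k) (φ j) := by
    rw [← Finset.sum_map Finset.univ φ (fun i => A i (φ j))]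
    refine (Finset.sum_subset (Finset.subset_univ _) fun i _ hi => ?_).symm
    refine (hφ i ?_).2 _ ?_
    · rintro ⟨k, rfl⟩; exact hi (by simp)
    · rintro rfl; exact hi (by simp)
  simpa [h1] using h.odd (φ j)

/-- Deleted columns are zero off the diagonal, so the surviving rows lose only zeros and no new unit
row appears. Hence one reduction step suffices. -/
theorem IsWirthBlock.not_isUnitRow_submatrix {p : ι → Prop} {A : Matrix ι ι ℤ}
    (h : IsWirthBlock p A) (φ : κ ↪ ι) (hφ : ∀ i, i ∉ Set.range φ → IsUnitRow p A i) (k : κ)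
    (hk : ¬ IsUnitRow p A (φ k)) :
    ¬ IsUnitRow (fun k => p (φ k)) (A.submatrix φ φ) k := by
  intro hu
  refine hk ⟨hu.1, fun j hj => ?_⟩
  by_cases hjr : j ∈ Set.range φ
  · obtain ⟨l, rfl⟩ := hjr
    exact hu.2 l fun hl => hj (by rw [hl])
  · exact h.col_zero _ _ hj.symm (hφ j hjr).1

theorem IsWirthBlock.reindex {p : ι → Prop} {A : Matrix ι ι ℤ} (h : IsWirthBlock p A)
    (σ : κ ≃ ι) : IsWirthBlock (fun k => p (σ k)) (A.submatrix σ σ) :=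
  h.submatrix σ.toEmbedding fun i hi => (hi (by simp)).elim

variable {p : ι → Prop} {A : Matrix ι ι ℤ}

open Classical in
/-- The coordinates of the lattice basis with respect to the columns. -/
def inverseCoord (p : ι → Prop) (A : Matrix ι ι ℤ) (i j : ι) : ℝ :=
  if i = j then (if p j then 1 / 2 else 1) else -(A i j : ℝ) / 2

theorem IsWirthBlock.columnVectors_of_not {M : Type*} [NormedAddCommGroup M]
    (h : IsWirthBlock p A) (b : ι → M) {j : ι} (hj : ¬ p j) : columnVectors b A j = b j := by
  classical
  unfold columnVectors
  rw [Finset.sum_eq_single j, h.diag_one j hj, one_smul]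
  · intro i _ hi
    rw [h.col_zero i j hi hj, zero_smul]
  · simp

/-- The matrix is inverted by hand: a column j with diagonal 2 reads e_j = 2b_j + Σ A_ij e_i,
because every i with A_ij ≠ 0, i ≠ j, has e_i = b_i. -/
theorem IsWirthBlock.basis_eq (h : IsWirthBlock p A) (b : ι → V) (j : ι) :
    b j = ∑ i, inverseCoord p A i j • columnVectors b A i := by
  classical
  by_cases hj : p j
  · have h1 : columnVectors b A j = (2 : ℝ) • b j
        + ∑ i ∈ Finset.univ.erase j, (A i j : ℝ) • columnVectors b A i := by
      conv_lhs => unfold columnVectors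
      rw [← Finset.add_sum_erase _ _ (Finset.mem_univ j), h.diag_two j hj]
      congr 1
      · rw [← Int.cast_smul_eq_zsmul ℝ]; norm_num
      · refine Finset.sum_congr rfl fun i hi => ?_
        have hij := Finset.ne_of_mem_erase hi
        by_cases hi : p i
        · simp [h.row_zero i j hij hi]
        · rw [h.columnVectors_of_not b hi, Int.cast_smul_eq_zsmul]
    rw [← Finset.add_sum_erase _ _ (Finset.mem_univ j)]
    have h2 : ∑ i ∈ Finset.univ.erase j, inverseCoord p A i j • columnVectors b A i
        = (-(1 / 2 : ℝ)) • ∑ i ∈ Finset.univ.erase j, (A i j : ℝ) • columnVectors b A i := by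
      rw [Finset.smul_sum]
      refine Finset.sum_congr rfl fun i hi => ?_
      rw [smul_smul, inverseCoord, if_neg (Finset.ne_of_mem_erase hi)]
      congr 1
      ring
    rw [h2, h1, inverseCoord, if_pos rfl, if_pos hj]
    module
  · rw [Finset.sum_eq_single j, inverseCoord, if_pos rfl, if_neg hj,
      h.columnVectors_of_not b hj, one_smul]
    · intro i _ hi
      rw [inverseCoord, if_neg hi, h.col_zero i j hi hj]
      simp
    · simp

/-- The columns of a Wirth matrix form a basis. -/
def columnBasis (h : IsWirthBlock p A) (b : Basis ι ℝ V) : Basis ι ℝ V :=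
  basisOfTopLeSpanOfCardEqFinrank (columnVectors b A)
    (by
      rw [← b.span_eq, Submodule.span_le]
      rintro _ ⟨j, rfl⟩
      rw [h.basis_eq b j]
      exact Submodule.sum_mem _ fun i _ =>
        Submodule.smul_mem _ _ (Submodule.subset_span ⟨i, rfl⟩))
    (finrank_eq_card_basis b).symm

@[simp]
theorem coe_columnBasis (h : IsWirthBlock p A) (b : Basis ι ℝ V) :
    ⇑(columnBasis h b) = columnVectors b A :=
  coe_basisOfTopLeSpanOfCardEqFinrank _ _ _

theorem columnBasis_repr (h : IsWirthBlock p A) (b : Basis ι ℝ V) (i j : ι) :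
    (columnBasis h b).repr (b j) i = inverseCoord p A i j := by
  classical
  conv_lhs => rw [h.basis_eq b j, ← coe_columnBasis h b]
  rw [(columnBasis h b).repr_sum_self]

/-- All conditions are additive, so they are checked on the lattice basis, where the coordinates are
the entries of `inverseCoord`; odd column sums make the coordinate sums integral. -/
theorem evenFrame_columnBasis (h : IsWirthBlock p A) (b : Basis ι ℝ V) :
    EvenFrame (Submodule.span ℤ (Set.range b)) (columnBasis h b) := by
  classical
  refine ⟨fun i => ?_, fun x hx i => ?_, fun x hx => ?_⟩
  · rw [coe_columnBasis]
    exact Submodule.sum_mem _ fun j _ =>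
      Submodule.smul_mem _ _ (Submodule.subset_span ⟨j, rfl⟩)
  · induction hx using Submodule.span_induction with
    | mem x hx =>
      obtain ⟨j, rfl⟩ := hx
      rw [columnBasis_repr, inverseCoord]
      split_ifs
      · exact ⟨1, by norm_num⟩
      · exact ⟨2, by norm_num⟩
      · exact ⟨-A i j, by push_cast; ring⟩
    | zero => exact ⟨0, by simp⟩
    | add x y _ _ hx hy =>
      obtain ⟨m, hm⟩ := hx
      obtain ⟨n, hn⟩ := hy
      exact ⟨m + n, by push_cast; rw [← hm, ← hn, map_add, Finsupp.add_apply]; ring⟩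
    | smul c x _ hx =>
      obtain ⟨m, hm⟩ := hx
      refine ⟨c * m, ?_⟩
      push_cast
      rw [← hm, ← Int.cast_smul_eq_zsmul ℝ, map_smul, Finsupp.smul_apply, smul_eq_mul]
      ring
  · induction hx using Submodule.span_induction with
    | mem x hx =>
      obtain ⟨j, rfl⟩ := hx
      obtain ⟨k, hk⟩ := h.odd j
      rw [← Finset.add_sum_erase _ _ (Finset.mem_univ j)] at hk ⊢
      have h2 : ∑ i ∈ Finset.univ.erase j, (columnBasis h b).repr (b j) i
          = -((∑ i ∈ Finset.univ.erase j, A i j : ℤ) : ℝ) / 2 := by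
        rw [Int.cast_sum, ← Finset.sum_neg_distrib, Finset.sum_div]
        refine Finset.sum_congr rfl fun i hi => ?_
        rw [columnBasis_repr, inverseCoord, if_neg (Finset.ne_of_mem_erase hi)]
      rw [h2, columnBasis_repr, inverseCoord, if_pos rfl]
      by_cases hj : p j
      · rw [h.diag_two j hj] at hk
        refine ⟨1 - k, ?_⟩
        rw [if_pos hj, show ∑ i ∈ Finset.univ.erase j, A i j = 2 * k - 1 by omega]
        push_cast; ring
      · rw [h.diag_one j hj] at hk
        refine ⟨1 - k, ?_⟩
        rw [if_neg hj, show ∑ i ∈ Finset.univ.erase j, A i j = 2 * k by omega]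
        push_cast; ring
    | zero => exact ⟨0, by simp⟩
    | add x y _ _ hx hy =>
      obtain ⟨m, hm⟩ := hx
      obtain ⟨n, hn⟩ := hy
      refine ⟨m + n, ?_⟩
      push_cast
      rw [← hm, ← hn, ← Finset.sum_add_distrib]
      simp
    | smul c x _ hx =>
      obtain ⟨m, hm⟩ := hx
      refine ⟨c * m, ?_⟩
      push_cast
      rw [← hm, ← Int.cast_smul_eq_zsmul ℝ, map_smul, Finset.mul_sum]
      simp

theorem half_ne_intCast (n : ℤ) : (1 / 2 : ℝ) ≠ n := by
  intro h
  have h1 : (1 : ℝ) = 2 * n := by linarith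
  have h2 : (1 : ℤ) = 2 * n := by exact_mod_cast h1
  omega

/-- The i-th row of the inverse matrix contains ±1/2 exactly when row i of A has the diagonal entry
2 or an off-diagonal 1. -/
theorem isIntegralCoord_columnBasis (h : IsWirthBlock p A) (b : Basis ι ℝ V) (i : ι) :
    IsIntegralCoord (Submodule.span ℤ (Set.range b)) (columnBasis h b) i ↔ IsUnitRow p A i := by
  classical
  constructor
  · intro hi
    have hb : ∀ j, ∃ n : ℤ, inverseCoord p A i j = n := fun j => by
      rw [← columnBasis_repr h b]
      exact hi _ (Submodule.subset_span ⟨j, rfl⟩)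
    refine ⟨fun hp => ?_, fun j hj => ?_⟩
    · obtain ⟨n, hn⟩ := hb i
      rw [inverseCoord, if_pos rfl, if_pos hp] at hn
      exact half_ne_intCast n hn
    · obtain ⟨n, hn⟩ := hb j
      rw [inverseCoord, if_neg hj.symm] at hn
      rcases h.zero_or_one i j hj.symm with h0 | h1
      · exact h0
      · rw [h1] at hn
        refine absurd ?_ (half_ne_intCast (-n))
        push_cast at hn ⊢
        linarith
  · intro hi x hx
    induction hx using Submodule.span_induction with
    | mem x hx =>
      obtain ⟨j, rfl⟩ := hx
      rw [columnBasis_repr, inverseCoord]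
      by_cases hij : i = j
      · subst hij
        exact ⟨1, by simp [hi.1]⟩
      · exact ⟨0, by simp [hij, hi.2 j (Ne.symm hij)]⟩
    | zero => exact ⟨0, by simp⟩
    | add x y _ _ hx hy =>
      obtain ⟨m, hm⟩ := hx
      obtain ⟨n, hn⟩ := hy
      exact ⟨m + n, by push_cast; rw [← hm, ← hn, map_add, Finsupp.add_apply]⟩
    | smul c x _ hx =>
      obtain ⟨m, hm⟩ := hx
      refine ⟨c * m, ?_⟩
      push_cast
      rw [← hm, ← Int.cast_smul_eq_zsmul ℝ, map_smul, Finsupp.smul_apply, smul_eq_mul]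

end Blocks

/-! ### Comparison with the concrete block matrices. -/

section Wirth

variable {d : ℕ}

theorem sum_eq_of_zero_or_one {ι : Type*} [Fintype ι] (c : ι → ℤ) (hc : ∀ i, c i = 0 ∨ c i = 1) :
    ∑ i, c i = (Finset.univ.filter (fun i => c i = 1)).card := by
  rw [Finset.card_filter]
  push_cast
  refine Finset.sum_congr rfl fun i _ => ?_
  rcases hc i with h | h <;> simp [h]

section Entries

variable {f g : ℕ} (C : Matrix (Fin g) (Fin f) ℤ)

theorem blockMatrix_castAdd_castAdd (i j : Fin f) :
    blockMatrix rfl C (Fin.castAdd g i) (Fin.castAdd g j) = if i = j then 2 else 0 := by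
  unfold blockMatrix
  simp only [Matrix.reindex_apply, Matrix.submatrix_apply, Equiv.symm_trans_apply,
    finCongr_symm, finCongr_apply, Fin.cast_refl, id, finSumFinEquiv_symm_apply_castAdd,
    Matrix.fromBlocks_apply₁₁, Matrix.smul_apply, Matrix.one_apply]
  split_ifs <;> rfl

theorem blockMatrix_castAdd_natAdd (i : Fin f) (j : Fin g) :
    blockMatrix rfl C (Fin.castAdd g i) (Fin.natAdd f j) = 0 := by
  simp [blockMatrix]

theorem blockMatrix_natAdd_castAdd (i : Fin g) (j : Fin f) :
    blockMatrix rfl C (Fin.natAdd f i) (Fin.castAdd g j) = C i j := by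
  simp [blockMatrix, -Matrix.fromBlocks_apply₂₁, Matrix.fromBlocks_apply₂₁ _ _ C]

theorem blockMatrix_natAdd_natAdd (i j : Fin g) :
    blockMatrix rfl C (Fin.natAdd f i) (Fin.natAdd f j) = if i = j then 1 else 0 := by
  simp [blockMatrix, Matrix.one_apply]

end Entries

theorem isWirthBlock_blockMatrix {f g : ℕ} (h : f + g = d) {C : Matrix (Fin g) (Fin f) ℤ}
    (hC : IsAdmissibleBlock C) :
    IsWirthBlock (fun i : Fin d => (i : ℕ) < f) (blockMatrix h C) := by
  subst h
  refine ⟨fun i => ?_, fun i => ?_, fun i j => ?_, fun i j => ?_, fun i j => ?_, fun j => ?_⟩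
  · refine Fin.addCases (fun i => ?_) (fun i => ?_) i <;> simp [blockMatrix_castAdd_castAdd, blockMatrix_natAdd_natAdd]
  · refine Fin.addCases (fun i => ?_) (fun i => ?_) i <;> simp [blockMatrix_castAdd_castAdd, blockMatrix_natAdd_natAdd]
  · refine Fin.addCases (fun i => ?_) (fun i => ?_) i <;>
      refine Fin.addCases (fun j => ?_) (fun j => ?_) j <;> simp +contextual [blockMatrix_castAdd_castAdd, blockMatrix_castAdd_natAdd]
  · refine Fin.addCases (fun i => ?_) (fun i => ?_) i <;>
      refine Fin.addCases (fun j => ?_) (fun j => ?_) j <;> simp +contextual [blockMatrix_castAdd_natAdd, blockMatrix_natAdd_natAdd]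
  · refine Fin.addCases (fun i => ?_) (fun i => ?_) i <;>
      refine Fin.addCases (fun j => ?_) (fun j => ?_) j <;>
      simp +contextual [blockMatrix_castAdd_castAdd, blockMatrix_castAdd_natAdd, blockMatrix_natAdd_castAdd, blockMatrix_natAdd_natAdd, hC.1]
  · refine Fin.addCases (fun j => ?_) (fun j => ?_) j
    · rw [Fin.sum_univ_add]
      simp only [blockMatrix_castAdd_castAdd, blockMatrix_natAdd_castAdd, Finset.sum_ite_eq', Finset.mem_univ, if_true]
      rw [sum_eq_of_zero_or_one _ fun i => hC.1 i j]
      exact even_two.add_odd (by exact_mod_cast hC.2 j)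
    · rw [Fin.sum_univ_add]
      simp [blockMatrix_castAdd_natAdd, blockMatrix_natAdd_natAdd]

/-- Downward closedness of p makes it an initial segment, whose length is f. -/
theorem IsWirthBlock.exists_block {p : Fin d → Prop} {A : Matrix (Fin d) (Fin d) ℤ}
    (hA : IsWirthBlock p A) (hp : ∀ i j, i ≤ j → p j → p i) :
    ∃ (f g : ℕ) (h : f + g = d) (C : Matrix (Fin g) (Fin f) ℤ),
      (f < d ∨ d = 0) ∧ IsAdmissibleBlock C ∧ A = blockMatrix h C ∧ ∀ i : Fin d, p i ↔ (i : ℕ) < f := by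
  classical
  obtain ⟨f, hfd, hf⟩ : ∃ f, f ≤ d ∧ ∀ i : Fin d, p i ↔ (i : ℕ) < f := by
    by_cases hall : ∀ i, p i
    · exact ⟨d, le_rfl, fun i => ⟨fun _ => i.2, fun _ => hall i⟩⟩
    · push Not at hall
      have hex : ∃ n : ℕ, ∃ h : n < d, ¬ p ⟨n, h⟩ := by
        obtain ⟨i, hi⟩ := hall
        exact ⟨i, i.2, hi⟩
      obtain ⟨h1, h2⟩ := Nat.find_spec hex
      refine ⟨Nat.find hex, h1.le, fun i => ⟨fun hi => ?_, fun hi => ?_⟩⟩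
      · by_contra hlt
        exact h2 (hp _ i (not_lt.1 hlt) hi)
      · by_contra hpi
        exact Nat.find_min hex hi ⟨i.2, hpi⟩
  obtain ⟨g, rfl⟩ := Nat.exists_eq_add_of_le hfd
  set C : Matrix (Fin g) (Fin f) ℤ := fun i j => A (Fin.natAdd f i) (Fin.castAdd g j) with hCdef
  have hne : ∀ (i : Fin g) (j : Fin f), Fin.natAdd f i ≠ Fin.castAdd g j := fun i j h => by
    have h1 := congrArg Fin.val h
    have h2 := j.2
    simp at h1
    omega
  have hC01 : ∀ i j, C i j = 0 ∨ C i j = 1 := fun i j => hA.zero_or_one _ _ (hne i j)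
  have hC : IsAdmissibleBlock C := by
    refine ⟨hC01, fun j => ?_⟩
    have h1 := hA.odd (Fin.castAdd g j)
    rw [Fin.sum_univ_add, Finset.sum_eq_single j,
      hA.diag_two _ ((hf _).2 (by simp)), sum_eq_of_zero_or_one _ fun i => hC01 i j,
      Int.odd_add, Int.even_coe_nat, ← not_iff_not, Nat.not_even_iff_odd] at h1
    · exact h1.1 (by decide)
    · intro i _ hi
      exact hA.row_zero _ _ (by simpa using hi) ((hf _).2 (by simp))
    · simp
  refine ⟨f, g, rfl, C, ?_, hC, ?_, hf⟩
  -- The bound on f is automatic: for g = 0 a column of C would be empty and could not contain an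
  -- odd number of ones.
  · rcases Nat.eq_zero_or_pos g with rfl | hg
    · right
      rcases Nat.eq_zero_or_pos f with rfl | hf
      · rfl
      · have := hC.2 ⟨0, hf⟩
        simp at this
    · left; omega
  · ext i j
    refine Fin.addCases (fun i => ?_) (fun i => ?_) i <;>
      refine Fin.addCases (fun j => ?_) (fun j => ?_) j
    · rw [blockMatrix_castAdd_castAdd]
      by_cases hij : i = j
      · subst hij
        rw [hA.diag_two _ ((hf _).2 (by simp)), if_pos rfl]
      · rw [hA.row_zero _ _ (by simpa using hij) ((hf _).2 (by simp)), if_neg hij]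
    · rw [hA.row_zero _ _ (hne j i).symm ((hf _).2 (by simp)), blockMatrix_castAdd_natAdd]
    · rw [blockMatrix_natAdd_castAdd]
    · rw [blockMatrix_natAdd_natAdd]
      by_cases hij : i = j
      · subst hij
        rw [hA.diag_one _ (by simp [hf]), if_pos rfl]
      · rw [hA.col_zero _ _ (by simpa using hij) (by simp [hf]), if_neg hij]

/-- Trades block sizes for a predicate on indices, under which reordering and deleting indices are
painless. -/
theorem isWirth_iff (A : Matrix (Fin d) (Fin d) ℤ) :
    IsWirth A ↔ ∃ p : Fin d → Prop, (∀ i j, i ≤ j → p j → p i) ∧ IsWirthBlock p A := by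
  constructor
  · rintro ⟨f, g, h, C, -, hC, rfl⟩
    exact ⟨fun i => (i : ℕ) < f, fun i j hij hj => lt_of_le_of_lt hij hj,
      isWirthBlock_blockMatrix h hC⟩
  · rintro ⟨p, hp, hA⟩
    obtain ⟨f, g, h, C, h0, hC, hAC, -⟩ := hA.exists_block hp
    exact ⟨f, g, h, C, h0, hC, hAC⟩

/-- Rows with diagonal 2 contain no 1 at all, and every other row already has its 1 on the diagonal.
-/
theorem mem_singleOneRows {p : Fin d → Prop} {A : Matrix (Fin d) (Fin d) ℤ}
    (hA : IsWirthBlock p A) (i : Fin d) : i ∈ singleOneRows A ↔ IsUnitRow p A i := by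
  classical
  rw [singleOneRows, Finset.mem_filter, and_iff_right (Finset.mem_univ i), Finset.card_eq_one]
  constructor
  · rintro ⟨k, hk⟩
    have hmem : ∀ j, A i j = 1 ↔ j = k := fun j => by
      simpa using congrArg (fun s : Finset (Fin d) => j ∈ s) hk
    have hpi : ¬ p i := fun hpi => by
      have h1 := (hmem k).2 rfl
      by_cases hik : i = k
      · subst hik
        rw [hA.diag_two i hpi] at h1
        omega
      · rw [hA.row_zero i k hik hpi] at h1
        omega
    have hik : i = k := (hmem i).1 (hA.diag_one i hpi)
    refine ⟨hpi, fun j hj => (hA.zero_or_one i j hj.symm).resolve_right fun h => hj ?_⟩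
    rw [(hmem j).1 h, hik]
  · rintro ⟨hpi, h⟩
    refine ⟨i, ?_⟩
    ext j
    simp only [Finset.mem_filter, Finset.mem_univ, true_and, Finset.mem_singleton]
    constructor
    · intro h1
      by_contra hj
      rw [h j hj] at h1
      omega
    · rintro rfl
      exact hA.diag_one j hpi

theorem isOneMinimalWirth_iff {p : Fin d → Prop} {A : Matrix (Fin d) (Fin d) ℤ}
    (hA : IsWirthBlock p A) (hp : ∀ i j, i ≤ j → p j → p i) :
    IsOneMinimalWirth A ↔ ∀ i, ¬ IsUnitRow p A i := by
  constructor
  · rintro ⟨f, g, rfl, C, -, hC, rfl, hmin⟩ i hi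
    have h1 := isWirthBlock_blockMatrix rfl hC
    -- The given p need not be syntactically the condition i < f; `singleOneRows` depends only on
    -- the matrix and carries the statement from one to the other.
    rw [← mem_singleOneRows hA, mem_singleOneRows h1] at hi
    obtain ⟨h2, h3⟩ := hi
    obtain ⟨k, rfl⟩ : ∃ k, Fin.natAdd f k = i :=
      ⟨⟨i - f, by have := i.2; omega⟩, by ext; simp; omega⟩
    obtain ⟨j, hj⟩ := hmin k
    have h4 := h3 (Fin.castAdd g j) (by
      intro h
      have h5 := congrArg Fin.val h
      have h6 := j.2
      simp at h5
      omega)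
    rw [blockMatrix_natAdd_castAdd, hj] at h4
    exact one_ne_zero h4
  · intro hmin
    obtain ⟨f, g, rfl, C, h0, hC, rfl, hpf⟩ := hA.exists_block hp
    refine ⟨f, g, rfl, C, h0, hC, rfl, fun i => ?_⟩
    by_contra hno
    push Not at hno
    refine hmin (Fin.natAdd f i) ⟨by simp [hpf], fun j hj => ?_⟩
    revert hj
    refine Fin.addCases (fun j hj => ?_) (fun j hj => ?_) j
    · simpa [blockMatrix_natAdd_castAdd] using (hC.1 i j).resolve_right (hno j)
    · have : i ≠ j := fun h => hj (by rw [h])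
      simp [blockMatrix_natAdd_natAdd, this]

end Wirth

/-! ### Existence of the normal form: Gaussian elimination on the code. -/

section Existence

variable {V : Type*} [NormedAddCommGroup V] [NormedSpace ℝ V]
variable {ι κ : Type*} [Fintype ι] [Fintype κ]

theorem columnVectors_submatrix {M : Type*} [NormedAddCommGroup M] (b : ι → M) (A : Matrix ι ι ℤ)
    (σ : κ ≃ ι) (k : κ) :
    columnVectors (fun k => b (σ k)) (A.submatrix σ σ) k = columnVectors b A (σ k) := by
  unfold columnVectors
  exact σ.sum_comp fun i => A i (σ k) • b i

open Classical in
/-- A family of lattice vectors whose coordinates in `J` are those of `(1/2) e j`, for `j` in `J`. -/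
def IsHalfFamily (L : Submodule ℤ V) (e : Basis ι ℝ V) (J : Finset ι) (c : ι → V) : Prop :=
  ∀ j ∈ J, c j ∈ L ∧ ∀ k ∈ J, e.repr (c j) k = if k = j then 1 / 2 else 0

open Classical in
theorem exists_maximal_halfFamily (L : Submodule ℤ V) (e : Basis ι ℝ V) :
    ∃ J : Finset ι, (∃ c, IsHalfFamily L e J c) ∧
      ∀ k, k ∉ J → ¬ ∃ c, IsHalfFamily L e (insert k J) c := by
  obtain ⟨J, hJ⟩ := Finset.exists_maximal
    (s := Finset.univ.filter fun J : Finset ι => ∃ c, IsHalfFamily L e J c)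
    ⟨∅, by simp [IsHalfFamily]⟩
  refine ⟨J, (Finset.mem_filter.1 hJ.1).2, fun k hk hex => hk ?_⟩
  exact hJ.2 (Finset.mem_filter.2 ⟨Finset.mem_univ _, hex⟩) (Finset.subset_insert k J)
    (Finset.mem_insert_self k J)

variable {L : Submodule ℤ V} {e : Basis ι ℝ V}

open Classical in
/-- Lattice vectors vanishing on a maximal set `J` have integral coordinates. -/
theorem EvenFrame.integral_of_maximal (h : EvenFrame L e) {J : Finset ι} {c : ι → V}
    (hc : IsHalfFamily L e J c) (hmax : ∀ k, k ∉ J → ¬ ∃ c, IsHalfFamily L e (insert k J) c)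
    {x : V} (hx : x ∈ L) (hx0 : ∀ j ∈ J, e.repr x j = 0) (k : ι) : ∃ n : ℤ, e.repr x k = n := by
  by_cases hk : k ∈ J
  · exact ⟨0, by simp [hx0 k hk]⟩
  by_contra hno
  obtain ⟨n, hn⟩ := h.two_mul x hx k
  obtain ⟨m, rfl | rfl⟩ := Int.even_or_odd' n
  · refine hno ⟨m, ?_⟩
    push_cast at hn
    linarith
  -- Pivoting: y has coordinate 1/2 at k and vanishes on J, so subtracting 2(c_j)_k times y from
  -- each c_j clears position k, and J could be enlarged by k.
  set y : V := x - m • e k with hy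
  have hyL : y ∈ L := L.sub_mem hx (L.smul_mem m (h.mem k))
  have hyk : e.repr y k = 1 / 2 := by
    rw [hy, ← Int.cast_smul_eq_zsmul ℝ]
    push_cast at hn
    simp
    linarith
  have hyJ : ∀ j ∈ J, e.repr y j = 0 := fun j hj => by
    have : k ≠ j := by rintro rfl; exact hk hj
    rw [hy, ← Int.cast_smul_eq_zsmul ℝ]
    simp [hx0 j hj, this]
  choose! t ht using fun j (hj : j ∈ J) => h.two_mul (c j) (hc j hj).1 k
  refine hmax k hk ⟨fun j => if j = k then y else c j - t j • y, fun j hj => ?_⟩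
  by_cases hjk : j = k
  · subst hjk
    simp only [if_true]
    refine ⟨hyL, fun l hl => ?_⟩
    by_cases hlj : l = j
    · simp [hlj, hyk]
    · simp [hlj, hyJ l ((Finset.mem_insert.1 hl).resolve_left hlj)]
  · have hjJ := (Finset.mem_insert.1 hj).resolve_left hjk
    simp only [hjk, if_false]
    refine ⟨L.sub_mem (hc j hjJ).1 (L.smul_mem _ hyL), fun l hl => ?_⟩
    rw [← Int.cast_smul_eq_zsmul ℝ, map_sub, map_smul, Finsupp.sub_apply, Finsupp.smul_apply,
      smul_eq_mul]
    by_cases hlk : l = k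
    · subst hlk
      rw [hyk, ← ht j hjJ, if_neg (Ne.symm hjk)]
      ring
    · have hlJ := (Finset.mem_insert.1 hl).resolve_left hlk
      rw [hyJ l hlJ, (hc j hjJ).2 l hlJ]
      ring

/-- The coordinates outside `J` of a half family can be taken in `{0, -1/2}`. -/
theorem EvenFrame.exists_normalized (h : EvenFrame L e) {J : Finset ι} {c : ι → V}
    (hc : IsHalfFamily L e J c) : ∃ c', IsHalfFamily L e J c' ∧
      ∀ j ∈ J, ∀ i, i ∉ J → e.repr (c' j) i = 0 ∨ e.repr (c' j) i = -1 / 2 := by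
  classical
  have key : ∀ j ∈ J, ∃ y ∈ L, (∀ k ∈ J, e.repr y k = if k = j then 1 / 2 else 0) ∧
      ∀ i, i ∉ J → e.repr y i = 0 ∨ e.repr y i = -1 / 2 := by
    intro j hj
    choose t ht using h.two_mul (c j) (hc j hj).1
    -- The coordinate t/2 is rounded up: subtracting (t + 1) / 2 (integer division) leaves 0 for
    -- even t and -1/2 for odd t. The negative residue makes the entries of C equal to +1.
    have hrepr : ∀ i, e.repr (c j - ∑ k ∈ Jᶜ, (((t k + 1) / 2 : ℤ) : ℝ) • e k) i =
        e.repr (c j) i - if i ∈ J then 0 else (((t i + 1) / 2 : ℤ) : ℝ) := by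
      intro i
      rw [map_sub, Finsupp.sub_apply, map_sum, Finsupp.finsetSum_apply]
      congr 1
      by_cases hi : i ∈ J
      · rw [if_pos hi]
        refine Finset.sum_eq_zero fun k hk => ?_
        have : k ≠ i := by rintro rfl; exact (Finset.mem_compl.1 hk) hi
        simp [this]
      · rw [if_neg hi, Finset.sum_eq_single i]
        · simp
        · intro k _ hk
          simp [hk]
        · intro hi'
          exact absurd (Finset.mem_compl.2 hi) hi'
    refine ⟨c j - ∑ k ∈ Jᶜ, (((t k + 1) / 2 : ℤ) : ℝ) • e k,
      L.sub_mem (hc j hj).1 (L.sum_mem fun k _ => ?_), fun k hk => ?_, fun i hi => ?_⟩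
    · rw [Int.cast_smul_eq_zsmul]
      exact L.smul_mem _ (h.mem k)
    · rw [hrepr, if_pos hk, sub_zero, (hc j hj).2 k hk]
    · rw [hrepr, if_neg hi]
      have h2 := ht i
      obtain ⟨m, hm | hm⟩ := Int.even_or_odd' (t i)
      · left
        rw [show (t i + 1) / 2 = m by omega]
        rw [hm] at h2
        push_cast at h2
        linarith
      · right
        rw [show (t i + 1) / 2 = m + 1 by omega]
        rw [hm] at h2
        push_cast at h2 ⊢
        linarith
  choose! c' h1 h2 h3 using key
  exact ⟨c', fun j hj => ⟨h1 j hj, h2 j hj⟩, h3⟩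

/-- The lattice basis consists of c_j for j in the maximal set J and of e_i elsewhere; maximality of
J is what makes it span all of L. -/
theorem EvenFrame.exists_isWirthBlock (h : EvenFrame L e) :
    ∃ (p : ι → Prop) (A : Matrix ι ι ℤ) (b : Basis ι ℝ V), IsWirthBlock p A ∧
      Submodule.span ℤ (Set.range b) = L ∧ columnVectors b A = e := by
  classical
  obtain ⟨J, ⟨c₀, hc₀⟩, hmax⟩ := exists_maximal_halfFamily L e
  obtain ⟨c, hc, hcn⟩ := h.exists_normalized hc₀
  choose! C hC01 hCval using fun j (hj : j ∈ J) i (hi : i ∉ J) =>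
    show ∃ z : ℤ, (z = 0 ∨ z = 1) ∧ e.repr (c j) i = -(z : ℝ) / 2 from by
      rcases hcn j hj i hi with h | h
      · exact ⟨0, Or.inl rfl, by rw [h]; norm_num⟩
      · exact ⟨1, Or.inr rfl, by rw [h]; norm_num⟩
  set A : Matrix ι ι ℤ := fun i j => if i = j then (if j ∈ J then 2 else 1) else
    if i ∉ J ∧ j ∈ J then C j i else 0 with hA
  set b₀ : ι → V := fun i => if i ∈ J then c i else e i with hb₀
  have hAdiag : ∀ i, A i i = if i ∈ J then 2 else 1 := fun i => by simp [hA]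
  have hAoff : ∀ i j, i ≠ j → A i j = if i ∉ J ∧ j ∈ J then C j i else 0 := fun i j hij => by
    simp [hA, hij]
  have hrepr : ∀ j ∈ J, ∀ i, i ≠ j → e.repr (c j) i = -(A i j : ℝ) / 2 := by
    intro j hj i hij
    rw [hAoff i j hij]
    by_cases hi : i ∈ J
    · rw [(hc j hj).2 i hi, if_neg hij, if_neg (by simp [hi])]
      simp
    · rw [if_pos ⟨hi, hj⟩, hCval j hj i hi]
  have hrepr_self : ∀ j ∈ J, e.repr (c j) j = 1 / 2 := fun j hj => by
    rw [(hc j hj).2 j hj, if_pos rfl]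
  have hcol : columnVectors b₀ A = e := by
    funext j
    unfold columnVectors
    by_cases hj : j ∈ J
    · have h1 : c j = (1 / 2 : ℝ) • e j - (1 / 2 : ℝ) •
          ∑ i ∈ Finset.univ.erase j, (A i j : ℝ) • e i := by
        conv_lhs => rw [← e.sum_repr (c j)]
        rw [← Finset.add_sum_erase _ _ (Finset.mem_univ j), hrepr_self j hj, Finset.smul_sum,
          sub_eq_add_neg, ← Finset.sum_neg_distrib]
        congr 1
        refine Finset.sum_congr rfl fun i hi => ?_
        rw [hrepr j hj i (Finset.ne_of_mem_erase hi), smul_smul, ← neg_smul]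
        congr 1
        ring
      have h2 : ∑ i ∈ Finset.univ.erase j, A i j • b₀ i =
          ∑ i ∈ Finset.univ.erase j, (A i j : ℝ) • e i := by
        refine Finset.sum_congr rfl fun i hi => ?_
        rw [Int.cast_smul_eq_zsmul]
        by_cases hi' : i ∈ J
        · rw [hAoff i j (Finset.ne_of_mem_erase hi), if_neg (by simp [hi']), zero_smul, zero_smul]
        · simp [hb₀, hi']
      rw [← Finset.add_sum_erase _ _ (Finset.mem_univ j), h2, hAdiag, if_pos hj]
      simp only [hb₀, if_pos hj]
      rw [h1, ← Int.cast_smul_eq_zsmul ℝ]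
      push_cast
      module
    · rw [Finset.sum_eq_single j, hAdiag, if_neg hj, one_smul]
      · simp [hb₀, hj]
      · intro i _ hij
        rw [hAoff i j hij, if_neg (by simp [hj]), zero_smul]
      · simp
  have hb₀L : ∀ i, b₀ i ∈ L := fun i => by
    by_cases hi : i ∈ J
    · simpa [hb₀, hi] using (hc i hi).1
    · simpa [hb₀, hi] using h.mem i
  have hspan : ⊤ ≤ Submodule.span ℝ (Set.range b₀) := by
    rw [← e.span_eq, Submodule.span_le]
    rintro _ ⟨j, rfl⟩
    rw [← hcol]
    refine Submodule.sum_mem _ fun i _ => ?_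
    rw [← Int.cast_smul_eq_zsmul ℝ]
    exact Submodule.smul_mem _ _ (Submodule.subset_span ⟨i, rfl⟩)
  refine ⟨(· ∈ J), A, basisOfTopLeSpanOfCardEqFinrank b₀ hspan (finrank_eq_card_basis e).symm,
    ⟨fun i hi => by simp [hAdiag, hi], fun i hi => by simp [hAdiag, hi],
      fun i j hij hi => by simp [hAoff i j hij, hi], fun i j hij hj => by simp [hAoff i j hij, hj],
      fun i j hij => ?_, fun j => ?_⟩, ?_, ?_⟩
  · rw [hAoff i j hij]
    split_ifs with hij'
    · exact hC01 j hij'.2 i hij'.1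
    · exact Or.inl rfl
  · by_cases hj : j ∈ J
    -- The coordinates of c_j add up to 1/2 minus half the off-diagonal column sum; as this is an
    -- integer n, the off-diagonal sum is 1 - 2n.
    · obtain ⟨n, hn⟩ := h.sum (c j) (hc j hj).1
      rw [← Finset.add_sum_erase _ _ (Finset.mem_univ j), hrepr_self j hj,
        Finset.sum_congr rfl fun i hi => hrepr j hj i (Finset.ne_of_mem_erase hi)] at hn
      rw [← Finset.add_sum_erase _ _ (Finset.mem_univ j), hAdiag, if_pos hj]
      rw [← Finset.sum_div, Finset.sum_neg_distrib, ← Int.cast_sum] at hn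
      have h3 : ((∑ i ∈ Finset.univ.erase j, A i j : ℤ) : ℝ) = ((1 - 2 * n : ℤ) : ℝ) := by
        push_cast at hn ⊢
        linarith
      rw [Int.cast_injective h3]
      exact ⟨1 - n, by ring⟩
    · rw [Finset.sum_eq_single j, hAdiag, if_neg hj]
      · exact odd_one
      · intro i _ hij
        simp [hAoff i j hij, hj]
      · simp
  · rw [coe_basisOfTopLeSpanOfCardEqFinrank]
    apply le_antisymm
    · rw [Submodule.span_le]
      rintro _ ⟨i, rfl⟩
      exact hb₀L i
    · intro x hx
      -- With t_j = 2x_j, subtracting Σ t_j c_j clears the coordinates in J; maximality then makes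
      -- the rest an integral combination of the e_i.
      choose t ht using h.two_mul x hx
      have hyL : x - ∑ j ∈ J, t j • c j ∈ L :=
        L.sub_mem hx (L.sum_mem fun j hj => L.smul_mem _ (hc j hj).1)
      have hy0 : ∀ k ∈ J, e.repr (x - ∑ j ∈ J, t j • c j) k = 0 := by
        intro k hk
        rw [map_sub, Finsupp.sub_apply, map_sum, Finsupp.finsetSum_apply, Finset.sum_eq_single k]
        · rw [← Int.cast_smul_eq_zsmul ℝ, map_smul, Finsupp.smul_apply, hrepr_self k hk, ← ht k,
            smul_eq_mul]
          ring
        · intro j hj hjk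
          rw [← Int.cast_smul_eq_zsmul ℝ, map_smul, Finsupp.smul_apply, (hc j hj).2 k hk,
            if_neg (Ne.symm hjk), smul_zero]
        · intro h; exact absurd hk h
      choose n hn using fun k => h.integral_of_maximal hc hmax hyL hy0 k
      have h4 : x = ∑ j ∈ J, t j • b₀ j + ∑ i, n i • (if i ∈ J then 0 else b₀ i) := by
        have h5 : ∑ j ∈ J, t j • b₀ j = ∑ j ∈ J, t j • c j :=
          Finset.sum_congr rfl fun j hj => by simp [hb₀, hj]
        rw [h5, ← sub_eq_iff_eq_add', ← e.sum_repr (x - ∑ j ∈ J, t j • c j)]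
        refine Finset.sum_congr rfl fun i _ => ?_
        by_cases hi : i ∈ J
        · rw [hy0 i hi]; simp [hi]
        · rw [hn i, Int.cast_smul_eq_zsmul]
          simp [hb₀, hi]
      rw [h4]
      refine Submodule.add_mem _ (Submodule.sum_mem _ fun j _ => Submodule.smul_mem _ _
        (Submodule.subset_span ⟨j, rfl⟩)) (Submodule.sum_mem _ fun i _ =>
        Submodule.smul_mem _ _ ?_)
      split_ifs
      · exact Submodule.zero_mem _
      · exact Submodule.subset_span ⟨i, rfl⟩
  · rw [coe_basisOfTopLeSpanOfCardEqFinrank, hcol]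

/-- The members of any decidable predicate can be listed first. -/
theorem exists_equiv_fin_lower {d : ℕ} (hd : Fintype.card ι = d) (p : ι → Prop) :
    ∃ σ : Fin d ≃ ι, ∀ i j, i ≤ j → p (σ j) → p (σ i) := by
  classical
  have hcard : Fintype.card {i // p i} + Fintype.card {i // ¬ p i} = d := by
    rw [← hd, ← Fintype.card_sum]
    exact Fintype.card_congr (Equiv.sumCompl p)
  subst hcard
  refine ⟨finSumFinEquiv.symm.trans
    ((Equiv.sumCongr (Fintype.equivFin _).symm (Fintype.equivFin _).symm).trans
      (Equiv.sumCompl p)), fun i j => ?_⟩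
  refine Fin.addCases (fun i => ?_) (fun i => ?_) i <;>
    refine Fin.addCases (fun j => ?_) (fun j => ?_) j
  · intro _ _
    simpa using ((Fintype.equivFin {i // p i}).symm i).2
  · intro _ _
    simpa using ((Fintype.equivFin {i // p i}).symm i).2
  · intro hij
    have h1 := j.2
    rw [Fin.le_def] at hij
    simp at hij
    omega
  · intro _ h
    exact absurd h (by simpa using ((Fintype.equivFin {i // ¬ p i}).symm j).2)

/-- Every even frame is given by the columns of a Wirth matrix in some lattice basis. -/
theorem EvenFrame.exists_isWirth (h : EvenFrame L e) {d : ℕ} (hd : Fintype.card ι = d) :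
    ∃ (A : Matrix (Fin d) (Fin d) ℤ) (b : Basis (Fin d) ℝ V) (σ : Fin d ≃ ι), IsWirth A ∧
      Submodule.span ℤ (Set.range b) = L ∧ columnVectors b A = fun j => e (σ j) := by
  obtain ⟨p, A, b, hA, hb, hcol⟩ := h.exists_isWirthBlock
  obtain ⟨σ, hσ⟩ := exists_equiv_fin_lower hd p
  refine ⟨A.submatrix σ σ, b.reindex σ.symm, σ, (isWirth_iff _).2 ⟨_, hσ, hA.reindex σ⟩, ?_, ?_⟩
  · rw [b.range_reindex, hb]
  · funext k
    rw [← hcol, ← columnVectors_submatrix]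
    congr 1
    funext i
    simp

end Existence

/-! ### Isomorphisms that permute frames, and integral coordinates under them. -/

section Isomorphisms

variable {V : Type*} [NormedAddCommGroup V] [NormedSpace ℝ V]
variable {V' : Type*} [NormedAddCommGroup V'] [NormedSpace ℝ V']
variable {ι κ : Type*}

theorem repr_equiv (b : Basis ι ℝ V) (b' : Basis κ ℝ V') (σ : ι ≃ κ) (x : V) (i : ι) :
    b'.repr (b.equiv b' σ x) (σ i) = b.repr x i := by
  classical
  have h : b'.coord (σ i) ∘ₗ (b.equiv b' σ).toLinearMap = b.coord i :=
    b.ext fun j => by simp [Finsupp.single_apply]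
  exact LinearMap.congr_fun h x

theorem equiv_mem_span_iff (b : Basis ι ℝ V) (b' : Basis κ ℝ V') (σ : ι ≃ κ) (x : V) :
    b.equiv b' σ x ∈ Submodule.span ℤ (Set.range b') ↔ x ∈ Submodule.span ℤ (Set.range b) := by
  rw [mem_span_basis_iff, mem_span_basis_iff, ← σ.forall_congr_right]
  simp only [repr_equiv]

theorem span_prod_basis (b : Basis ι ℝ V) (b' : Basis κ ℝ V') :
    Submodule.span ℤ (Set.range (b.prod b')) =
      (Submodule.span ℤ (Set.range b)).prod (Submodule.span ℤ (Set.range b')) := by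
  ext x
  rw [mem_span_basis_iff, Submodule.mem_prod, mem_span_basis_iff, mem_span_basis_iff]
  simp

theorem mem_stdLattice {n : ℕ} (x : Fin n → ℝ) :
    x ∈ stdLattice n ↔ ∀ i, ∃ m : ℤ, x i = m := by
  rw [stdLattice, mem_span_basis_iff]
  simp

theorem mem_intLattice (x : ℝ) : x ∈ intLattice ↔ ∃ m : ℤ, x = m := by
  rw [intLattice, Submodule.mem_span_singleton]
  simp [eq_comm]

theorem crossHull_prod (e : Basis ι ℝ V) (e' : Basis κ ℝ V') :
    crossHull (e.prod e') = freeSum (crossHull e) (crossHull e') := by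
  rw [freeSum_crossHull]
  congr 1
  funext i
  rcases i with i | i
  · simp [Basis.prod_apply]
  · simp [Basis.prod_apply]

theorem iso_of_equiv {L : Submodule ℤ V} {L' : Submodule ℤ V'} (e : Basis ι ℝ V)
    (e' : Basis κ ℝ V') (σ : ι ≃ κ) (hσ : ∀ x, e.equiv e' σ x ∈ L' ↔ x ∈ L) :
    Iso L (crossHull e) L' (crossHull e') := by
  refine ⟨e.equiv e' σ, hσ, ?_⟩
  refine (image_crossHull (e.equiv e' σ).toLinearMap e).trans ?_
  rw [← crossHull_reindex e' σ]
  simp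

theorem isIntegralCoord_congr {L : Submodule ℤ V} {L' : Submodule ℤ V'} {e : Basis ι ℝ V}
    {e' : Basis κ ℝ V'} {σ : ι ≃ κ} (hσ : ∀ x, e.equiv e' σ x ∈ L' ↔ x ∈ L) (i : ι) :
    IsIntegralCoord L' e' (σ i) ↔ IsIntegralCoord L e i := by
  have h1 : ∀ x, e'.repr (e.equiv e' σ x) (σ i) = e.repr x i := fun x =>
    repr_equiv e e' σ x i
  constructor
  · intro h x hx
    rw [← h1]
    exact h _ ((hσ x).2 hx)
  · intro h y hy
    obtain ⟨x, rfl⟩ := (e.equiv e' σ).surjective y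
    rw [h1]
    exact h x ((hσ x).1 hy)

theorem isIntegralCoord_prod_inl {L : Submodule ℤ V} {L' : Submodule ℤ V'} (e : Basis ι ℝ V)
    (e' : Basis κ ℝ V') (i : ι) :
    IsIntegralCoord (L.prod L') (e.prod e') (Sum.inl i) ↔ IsIntegralCoord L e i := by
  constructor
  · intro h x hx
    simpa using h (x, 0) ⟨hx, L'.zero_mem⟩
  · intro h x hx
    simpa using h x.1 hx.1

theorem isIntegralCoord_prod_inr {L : Submodule ℤ V} {L' : Submodule ℤ V'} (e : Basis ι ℝ V)
    (e' : Basis κ ℝ V') (i : κ) :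
    IsIntegralCoord (L.prod L') (e.prod e') (Sum.inr i) ↔ IsIntegralCoord L' e' i := by
  constructor
  · intro h x hx
    simpa using h (0, x) ⟨L.zero_mem, hx⟩
  · intro h x hx
    simpa using h x.2 hx.2

variable [Fintype ι] [Fintype κ]

theorem map_columnVectors {μ : Type*} (f : V →ₗ[ℝ] V') (b : ι → V) (A : Matrix ι μ ℤ) (j : μ) :
    f (columnVectors b A j) = columnVectors (fun i => f (b i)) A j := by
  unfold columnVectors
  rw [map_sum]
  refine Finset.sum_congr rfl fun i _ => map_zsmul f _ _

theorem EvenFrame.prod {L : Submodule ℤ V} {L' : Submodule ℤ V'} {e : Basis ι ℝ V}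
    {e' : Basis κ ℝ V'} (h : EvenFrame L e) (h' : EvenFrame L' e') :
    EvenFrame (L.prod L') (e.prod e') := by
  refine ⟨?_, fun x hx => ?_, fun x hx => ?_⟩
  · rintro (i | i)
    · simpa [Basis.prod_apply] using h.mem i
    · simpa [Basis.prod_apply] using h'.mem i
  · rintro (i | i)
    · simpa using h.two_mul x.1 hx.1 i
    · simpa using h'.two_mul x.2 hx.2 i
  · obtain ⟨m, hm⟩ := h.sum x.1 hx.1
    obtain ⟨n, hn⟩ := h'.sum x.2 hx.2
    exact ⟨m + n, by simp [hm, hn]⟩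

theorem evenFrame_basisFun (r : ℕ) : EvenFrame (stdLattice r) (Pi.basisFun ℝ (Fin r)) := by
  refine ⟨fun i => Submodule.subset_span ⟨i, rfl⟩, fun x hx i => ?_, fun x hx => ?_⟩
  · obtain ⟨n, hn⟩ := (mem_stdLattice x).1 hx i
    exact ⟨2 * n, by simp [hn]⟩
  · choose n hn using (mem_stdLattice x).1 hx
    exact ⟨∑ i, n i, by simp [hn]⟩

/-- Isomorphisms of reflexive crosspolytopes can be chosen without signs. -/
theorem EvenFrame.exists_equiv_of_iso {L : Submodule ℤ V} {L' : Submodule ℤ V'} {e : Basis ι ℝ V}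
    {e' : Basis κ ℝ V'} (h : EvenFrame L e) (h' : EvenFrame L' e')
    (hiso : Iso L (crossHull e) L' (crossHull e')) :
    ∃ σ : ι ≃ κ, ∀ x, e.equiv e' σ x ∈ L' ↔ x ∈ L := by
  obtain ⟨g, hgL, hgP⟩ := hiso
  obtain ⟨σ, hσ⟩ := exists_equiv_of_image_crossHull e e' g hgP
  refine ⟨σ, fun x => ?_⟩
  -- Dropping the signs changes the image of x by -2x_i e'_{σ i} for each flipped axis, an integral
  -- combination of frame vectors. Only half-integrality of x is assumed, since in the converse
  -- direction x is not yet known to lie in L.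
  have key : (∀ i, ∃ n : ℤ, 2 * e.repr x i = n) → g x - e.equiv e' σ x ∈ L' := by
    intro hx
    choose n hn using hx
    have h1 : g x - e.equiv e' σ x =
        ∑ i, e.repr x i • (g (e i) - e' (σ i)) := by
      conv_lhs => rw [← e.sum_repr x, map_sum, map_sum, ← Finset.sum_sub_distrib]
      refine Finset.sum_congr rfl fun i _ => ?_
      rw [map_smul, map_smul, ← smul_sub, e.equiv_apply]
    rw [h1]
    refine L'.sum_mem fun i _ => ?_
    rcases hσ i with h2 | h2 <;> rw [h2]
    · rw [sub_self, smul_zero]; exact L'.zero_mem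
    · have h3 : e.repr x i • (-e' (σ i) - e' (σ i)) = (-n i) • e' (σ i) := by
        rw [← Int.cast_smul_eq_zsmul ℝ, Int.cast_neg, ← hn i]
        module
      rw [h3]
      exact L'.smul_mem _ (h'.mem _)
  constructor
  · intro hx
    have h1 : ∀ i, ∃ n : ℤ, 2 * e.repr x i = n := fun i => by
      simpa only [repr_equiv] using h'.two_mul _ hx (σ i)
    rw [← hgL]
    simpa using L'.add_mem (key h1) hx
  · intro hx
    have h1 := key fun i => h.two_mul x hx i
    simpa using L'.sub_mem ((hgL x).2 hx) h1

theorem isIntegralCoord_basisFun {r : ℕ} (i : Fin r) :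
    IsIntegralCoord (stdLattice r) (Pi.basisFun ℝ (Fin r)) i := fun x hx => by
  simpa using (mem_stdLattice x).1 hx i

end Isomorphisms

/-! ### Splitting off factors, and the coordinate that belongs to an interval. -/

section Splitting

variable {V : Type*} [NormedAddCommGroup V] [NormedSpace ℝ V]
variable {V₁ : Type*} [NormedAddCommGroup V₁] [NormedSpace ℝ V₁]
variable {V₂ : Type*} [NormedAddCommGroup V₂] [NormedSpace ℝ V₂]
variable {ι κ₁ κ₂ : Type*} [Fintype ι] [Fintype κ₁] [Fintype κ₂]

/-- Block diagonal matrices define split polytopes. -/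
theorem splits_of_blocks (b : Basis ι ℝ V) (b₁ : Basis κ₁ ℝ V₁) (b₂ : Basis κ₂ ℝ V₂)
    (σ : κ₁ ⊕ κ₂ ≃ ι) (A : Matrix ι ι ℤ)
    (h12 : ∀ i j, A (σ (Sum.inl i)) (σ (Sum.inr j)) = 0)
    (h21 : ∀ i j, A (σ (Sum.inr i)) (σ (Sum.inl j)) = 0) :
    Splits (Submodule.span ℤ (Set.range b)) (crossHull (columnVectors b A))
      (Submodule.span ℤ (Set.range b₁)) (crossHull (columnVectors b₁
        (A.submatrix (fun i => σ (Sum.inl i)) (fun i => σ (Sum.inl i)))))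
      (Submodule.span ℤ (Set.range b₂)) (crossHull (columnVectors b₂
        (A.submatrix (fun i => σ (Sum.inr i)) (fun i => σ (Sum.inr i))))) := by
  refine Iso.symm ⟨(b₁.prod b₂).equiv b σ, fun x => ?_, ?_⟩
  · rw [equiv_mem_span_iff, span_prod_basis]
  · rw [freeSum_crossHull]
    refine (image_crossHull ((b₁.prod b₂).equiv b σ).toLinearMap _).trans ?_
    rw [← crossHull_reindex (columnVectors b A) σ]
    congr 1
    have h1 : ∀ i, (b₁.prod b₂).equiv b σ (b₁ i, 0) = b (σ (Sum.inl i)) := fun i => by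
      rw [← Basis.equiv_apply (b₁.prod b₂) (Sum.inl i) b σ]
      simp [Basis.prod_apply]
    have h2 : ∀ i, (b₁.prod b₂).equiv b σ (0, b₂ i) = b (σ (Sum.inr i)) := fun i => by
      rw [← Basis.equiv_apply (b₁.prod b₂) (Sum.inr i) b σ]
      simp [Basis.prod_apply]
    funext k
    have h3 : columnVectors b A (σ k) = ∑ i, A (σ (Sum.inl i)) (σ k) • b (σ (Sum.inl i)) +
        ∑ i, A (σ (Sum.inr i)) (σ k) • b (σ (Sum.inr i)) := by
      rw [← Fintype.sum_sum_type (fun l => A (σ l) (σ k) • b (σ l))]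
      exact (σ.sum_comp fun i => A i (σ k) • b i).symm
    rw [h3]
    rcases k with j | j
    · have h4 : ((columnVectors b₁ (A.submatrix (fun i => σ (Sum.inl i))
          (fun i => σ (Sum.inl i))) j, 0) : V₁ × V₂) =
          ∑ i, A (σ (Sum.inl i)) (σ (Sum.inl j)) • ((b₁ i, 0) : V₁ × V₂) := by
        unfold columnVectors
        ext <;> simp [Prod.fst_sum, Prod.snd_sum]
      simp only [Sum.elim_inl, LinearEquiv.coe_coe, h4, map_sum, map_zsmul, h1, h21, zero_smul,
        Finset.sum_const_zero, add_zero]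
    · have h4 : ((0, columnVectors b₂ (A.submatrix (fun i => σ (Sum.inr i))
          (fun i => σ (Sum.inr i))) j) : V₁ × V₂) =
          ∑ i, A (σ (Sum.inr i)) (σ (Sum.inr j)) • ((0, b₂ i) : V₁ × V₂) := by
        unfold columnVectors
        ext <;> simp [Prod.fst_sum, Prod.snd_sum]
      simp only [Sum.elim_inr, LinearEquiv.coe_coe, h4, map_sum, map_zsmul, h2, h12, zero_smul,
        Finset.sum_const_zero, zero_add]

/-- If `[-1,1]` splits off a crosspolytope then some coordinate is integral. -/
theorem EvenFrame.exists_isIntegralCoord_of_splits {L : Submodule ℤ V} {e : Basis ι ℝ V}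
    (h : EvenFrame L e) {L₂ : Submodule ℤ V₂} {Q : Set V₂}
    (hs : Splits L (crossHull e) intLattice (Set.Icc (-1 : ℝ) 1) L₂ Q) :
    ∃ i, IsIntegralCoord L e i := by
  obtain ⟨g, hgL, hgP⟩ := hs
  -- Vertices of a free sum lie in one of the two summands.
  have h1 : ∀ i, (g (e i)).2 = 0 ∧ |(g (e i)).1| ≤ 1 ∨ (g (e i)).1 = 0 := by
    intro i
    have h2 : g (e i) ∈ (freeSum (Set.Icc (-1 : ℝ) 1) Q).extremePoints ℝ := by
      rw [← hgP, ← image_extremePoints]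
      exact ⟨_, basis_mem_extremePoints e i, rfl⟩
    rcases extremePoints_convexHull_subset h2 with ⟨t, ht, h3⟩ | ⟨y, hy, h3⟩
    · left
      rw [← h3]
      exact ⟨rfl, abs_le.2 ht⟩
    · right
      rw [← h3]
  obtain ⟨i, hi⟩ : ∃ i, (g (e i)).1 ≠ 0 := by
    by_contra hno
    push Not at hno
    have h2 : LinearMap.fst ℝ ℝ V₂ ∘ₗ g.toLinearMap = 0 := e.ext fun i => by simpa using hno i
    have h3 := LinearMap.congr_fun h2 (g.symm (1, 0))
    simp at h3
  have hi2 := (h1 i).resolve_right hi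
  -- Two frame vectors mapped into the line of the interval would be parallel.
  have hj : ∀ j, j ≠ i → (g (e j)).1 = 0 := by
    classical
    intro j hji
    by_contra hj0
    have hj2 := (h1 j).resolve_right hj0
    have h3 : g ((g (e i)).1 • e j) = g ((g (e j)).1 • e i) := by
      rw [map_smul, map_smul]
      ext
      · simp [mul_comm]
      · simp [hi2.1, hj2.1]
    have h4 := congrArg (fun z => e.repr z j) (g.injective h3)
    simp [Ne.symm hji] at h4
    exact hi h4
  have hfst : ∀ x, (g x).1 = e.repr x i * (g (e i)).1 := by
    intro x
    have h2 : LinearMap.fst ℝ ℝ V₂ ∘ₗ g.toLinearMap = (g (e i)).1 • e.coord i := by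
      classical
      refine e.ext fun j => ?_
      by_cases hji : j = i
      · subst hji; simp
      · simp [hj j hji, hji]
    have h3 := LinearMap.congr_fun h2 x
    simpa [mul_comm] using h3
  obtain ⟨t, ht⟩ := (mem_intLattice _).1 ((hgL (e i)).2 (h.mem i)).1
  -- The interval component of g(e_i) is a nonzero integer of absolute value at most 1; hence x_i
  -- is, up to sign, the interval component of g(x), which is integral on L.
  have ht1 : t = 1 ∨ t = -1 := by
    rw [ht] at hi hi2
    have h2 : |t| ≤ 1 := by exact_mod_cast hi2.2
    have h3 : t ≠ 0 := by exact_mod_cast hi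
    have := abs_le.1 h2
    omega
  refine ⟨i, fun x hx => ?_⟩
  obtain ⟨n, hn⟩ := (mem_intLattice _).1 ((hgL x).2 hx).1
  rw [hfst x, ht] at hn
  rcases ht1 with rfl | rfl
  · exact ⟨n, by simpa using hn⟩
  · refine ⟨-n, ?_⟩
    push_cast at hn ⊢
    linarith

theorem EvenFrame.isOneIrreducible {L : Submodule ℤ V} {e : Basis ι ℝ V} (h : EvenFrame L e)
    (hno : ∀ i, ¬ IsIntegralCoord L e i) : IsOneIrreducible L (crossHull e) := by
  intro k Q _ hs
  obtain ⟨i, hi⟩ := h.exists_isIntegralCoord_of_splits hs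
  exact hno i hi

end Splitting

/-! ### Vertices of facets. -/

section Facets

variable {V : Type*} [NormedAddCommGroup V] [NormedSpace ℝ V] {ι : Type*} [Fintype ι]

/-- The vertices of a facet of a crosspolytope: one from each pair of opposite vertices. -/
theorem exists_basis_of_isFacet (e : Basis ι ℝ V) {F : Set V} (hF : IsFacet (crossHull e) F) :
    ∃ e' : Basis ι ℝ V, (∀ i, e' i = e i ∨ e' i = -e i) ∧ Set.range e' = F.extremePoints ℝ := by
  classical
  have : FiniteDimensional ℝ V := e.finiteDimensional_of_finite
  obtain ⟨hexp, hne, hdim⟩ := hF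
  obtain ⟨l, hl⟩ := hexp hne
  obtain ⟨x₀, hx₀⟩ := hne
  set m : ℝ := l x₀ with hm
  have hx₀' := hl ▸ hx₀
  have hle : ∀ y ∈ crossHull e, l y ≤ m := hx₀'.2
  have hmem : ∀ x, x ∈ F ↔ x ∈ crossHull e ∧ l x = m := by
    intro x
    rw [hl]
    constructor
    · rintro ⟨h1, h2⟩
      exact ⟨h1, le_antisymm (hle x h1) (h2 _ hx₀'.1)⟩
    · rintro ⟨h1, h2⟩
      exact ⟨h1, fun y hy => h2 ▸ hle y hy⟩
  have habs : ∀ i, |l (e i)| ≤ m := fun i => by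
    rw [abs_le]
    have h1 := hle _ (mem_crossHull_self e i)
    have h2 := hle _ (neg_mem_crossHull_self e i)
    rw [map_neg] at h2
    exact ⟨by linarith, h1⟩
  have hm0 : 0 ≤ m := by simpa using hle 0 (zero_mem_crossHull e)
  have hspan : ∀ f : Dual ℝ V, (∃ c, ∀ x ∈ F, f x = c) →
      vectorSpan ℝ F ≤ LinearMap.ker f := by
    rintro f ⟨c, hc⟩
    rw [vectorSpan_def, Submodule.span_le]
    rintro _ ⟨x, hx, y, hy, rfl⟩
    simp [hc x hx, hc y hy]
  -- If the maximum m of l were 0, then l would vanish and F would be the whole polytope, of too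
  -- large dimension.
  have hmpos : 0 < m := by
    rcases hm0.lt_or_eq with h | h
    · exact h
    exfalso
    have hl0 : ∀ x, l x = 0 := by
      have h1 : (l : V →ₗ[ℝ] ℝ) = 0 := e.ext fun i => by
        have := habs i
        rw [← h] at this
        simpa using this
      exact fun x => LinearMap.congr_fun h1 x
    have hzero : (0 : V) ∈ F := (hmem 0).2 ⟨zero_mem_crossHull e, by rw [hl0, ← h]⟩
    have h2 : vectorSpan ℝ F = ⊤ := by
      rw [eq_top_iff, ← e.span_eq, Submodule.span_le]
      rintro _ ⟨i, rfl⟩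
      have : e i ∈ F := (hmem _).2 ⟨mem_crossHull_self e i, by rw [hl0, ← h]⟩
      simpa using vsub_mem_vectorSpan ℝ this hzero
    rw [h2, finrank_top] at hdim
    omega
  -- If |l(e_i)| < m, then every maximizer of l has i-th coordinate 0. By dimension the direction
  -- space of F is then the kernel of that coordinate; it contains x₀ itself and lies in ker l,
  -- which contradicts l(x₀) = m > 0.
  have heq : ∀ i, |l (e i)| = m := by
    intro i
    by_contra hi
    have hlt : |l (e i)| < m := lt_of_le_of_ne (habs i) hi
    have hcoord : ∀ x ∈ F, e.coord i x = 0 := by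
      intro x hx
      obtain ⟨hx1, hx2⟩ := (hmem x).1 hx
      rw [mem_crossHull] at hx1
      have h1 : l x = ∑ j, e.repr x j * l (e j) := by
        conv_lhs => rw [← e.sum_repr x, map_sum]
        simp
      have h2 : m ≤ ∑ j, |e.repr x j| * |l (e j)| := by
        rw [← hx2, h1]
        exact Finset.sum_le_sum fun j _ => (le_abs_self _).trans (abs_mul _ _).le
      have h3 : ∑ j, |e.repr x j| * (m - |l (e j)|) ≤ 0 := by
        have h4 : ∑ j, |e.repr x j| * (m - |l (e j)|) =
            (∑ j, |e.repr x j|) * m - ∑ j, |e.repr x j| * |l (e j)| := by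
          rw [Finset.sum_mul, ← Finset.sum_sub_distrib]
          exact Finset.sum_congr rfl fun j _ => by ring
        rw [h4]
        nlinarith
      have h5 : |e.repr x i| * (m - |l (e i)|) ≤ 0 :=
        (Finset.single_le_sum (f := fun j => |e.repr x j| * (m - |l (e j)|))
          (fun j _ => mul_nonneg (abs_nonneg _) (by linarith [habs j]))
          (Finset.mem_univ i)).trans h3
      have h6 : |e.repr x i| ≤ 0 := by
        by_contra hpos
        nlinarith [mul_pos (not_le.1 hpos) (sub_pos.2 hlt)]
      exact abs_nonpos_iff.1 h6
    have hk1 := hspan (e.coord i) ⟨0, hcoord⟩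
    have hk2 := hspan (l : V →ₗ[ℝ] ℝ) ⟨m, fun x hx => ((hmem x).1 hx).2⟩
    have hd1 : finrank ℝ (LinearMap.ker (e.coord i)) + 1 = finrank ℝ V := by
      refine Module.Dual.finrank_ker_add_one_of_ne_zero fun h => ?_
      simpa using LinearMap.congr_fun h (e i)
    have hEq : vectorSpan ℝ F = LinearMap.ker (e.coord i) :=
      Submodule.eq_of_le_of_finrank_eq hk1 (by omega)
    have hx₀c : x₀ ∈ LinearMap.ker (e.coord i) := hcoord x₀ hx₀
    rw [← hEq] at hx₀c
    have h7 : l x₀ = 0 := hk2 hx₀c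
    exact hmpos.ne' h7
  have hsgn : ∀ i, ∃ u : ℝˣ, ((u : ℝ) = 1 ∨ (u : ℝ) = -1) ∧ u * l (e i) = m := by
    intro i
    rcases abs_choice (l (e i)) with h | h
    · exact ⟨1, Or.inl rfl, by rw [← heq i, h]; simp⟩
    · exact ⟨-1, Or.inr (by simp), by rw [← heq i, h]; simp⟩
  choose u hu hul using hsgn
  have hpm : ∀ i, e.unitsSMul u i = e i ∨ e.unitsSMul u i = -e i := fun i => by
    rw [e.unitsSMul_apply, Units.smul_def]
    rcases hu i with h | h <;> rw [h]
    · left; simp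
    · right; simp
  have hval : ∀ i, l (e.unitsSMul u i) = m := fun i => by
    rw [e.unitsSMul_apply, Units.smul_def, map_smul, smul_eq_mul, hul]
  refine ⟨e.unitsSMul u, hpm, Set.Subset.antisymm ?_ fun x hx => ?_⟩
  · rintro _ ⟨i, rfl⟩
    have hext : e.unitsSMul u i ∈ (crossHull e).extremePoints ℝ := by
      rcases hpm i with h | h <;> rw [h]
      exacts [basis_mem_extremePoints e i, neg_basis_mem_extremePoints e i]
    exact inter_extremePoints_subset_extremePoints_of_subset (fun y hy => ((hmem y).1 hy).1)
      ⟨(hmem _).2 ⟨hext.1, hval i⟩, hext⟩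
  · have hlx := ((hmem x).1 hx.1).2
    rcases extremePoints_crossHull_subset e
      (hexp.isExtreme.extremePoints_subset_extremePoints hx) with rfl | ⟨i, hi⟩
    · rw [map_zero] at hlx
      exact absurd hlx hmpos.ne
    · refine ⟨i, ?_⟩
      have h1 := hval i
      rcases hpm i with h | h <;> rcases hi with rfl | rfl
      · exact h
      · rw [h] at h1; rw [map_neg] at hlx; linarith
      · rw [h, map_neg] at h1; linarith
      · exact h

end Facets

/-! ### Matrix equivalence against isomorphism of polytopes. -/

section MatrixEquivalence

variable {V : Type*} [NormedAddCommGroup V] [NormedSpace ℝ V]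
variable {V' : Type*} [NormedAddCommGroup V'] [NormedSpace ℝ V']
variable {ι : Type*} [Fintype ι]

theorem isCSCrosspolytope_crossHull (e : Basis ι ℝ V) : IsCSCrosspolytope (crossHull e) := by
  have σ : ι ≃ Fin (finrank ℝ V) :=
    (Fintype.equivFin ι).trans (finCongr (finrank_eq_card_basis e).symm)
  refine ⟨e.reindex σ, ?_⟩
  rw [← crossHull_reindex (e.reindex σ) σ]
  simp

theorem columnVectors_mul {M μ ν : Type*} [NormedAddCommGroup M] [Fintype μ] (b : ι → M)
    (U : Matrix ι μ ℤ) (A : Matrix μ ν ℤ) (j : ν) :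
    columnVectors b (U * A) j = columnVectors (columnVectors b U) A j := by
  unfold columnVectors
  simp only [Matrix.mul_apply, Finset.sum_smul, Finset.smul_sum]
  rw [Finset.sum_comm]
  refine Finset.sum_congr rfl fun k _ => Finset.sum_congr rfl fun i _ => ?_
  rw [smul_smul, mul_comm]

theorem columnVectors_one {M : Type*} [NormedAddCommGroup M] [DecidableEq ι] (b : ι → M) (j : ι) :
    columnVectors b (1 : Matrix ι ι ℤ) j = b j := by
  unfold columnVectors
  simp [Matrix.one_apply]

theorem repr_columnVectors {μ : Type*} (b : Basis ι ℝ V) (A : Matrix ι μ ℤ) (i : ι) (j : μ) :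
    b.repr (columnVectors b A j) i = A i j := by
  unfold columnVectors
  simp only [← Int.cast_smul_eq_zsmul ℝ]
  rw [b.repr_sum_self]

theorem columnVectors_injective {μ : Type*} (b : Basis ι ℝ V) {A B : Matrix ι μ ℤ}
    (h : ∀ j, columnVectors b A j = columnVectors b B j) : A = B := by
  ext i j
  have h1 := congrArg (fun z => b.repr z i) (h j)
  simpa only [repr_columnVectors, Int.cast_inj] using h1

theorem columnVectors_mem {M μ : Type*} [NormedAddCommGroup M] (b : ι → M) (A : Matrix ι μ ℤ)
    (j : μ) : columnVectors b A j ∈ Submodule.span ℤ (Set.range b) :=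
  Submodule.sum_mem _ fun i _ => Submodule.smul_mem _ _ (Submodule.subset_span ⟨i, rfl⟩)

theorem map_mem_of_mem_span {ι : Type*} (f : V →ₗ[ℝ] V') {b : ι → V} {L' : Submodule ℤ V'}
    (h : ∀ i, f (b i) ∈ L') {x : V} (hx : x ∈ Submodule.span ℤ (Set.range b)) : f x ∈ L' := by
  have h1 : Submodule.span ℤ (Set.range b) ≤ L'.comap (f.restrictScalars ℤ) := by
    rw [Submodule.span_le]
    rintro _ ⟨i, rfl⟩
    exact h i
  exact h1 hx

variable {d : ℕ}

/-- Lattice bases are the real bases that span the lattice. -/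
theorem exists_int_basis {ι : Type*} {L : Submodule ℤ V} (b : Basis ι ℝ V)
    (h : Submodule.span ℤ (Set.range b) = L) : ∃ c : Basis ι ℤ L, ∀ i, (c i : V) = b i := by
  subst h
  exact ⟨b.restrictScalars ℤ, fun i => b.restrictScalars_apply ℤ i⟩

theorem exists_real_basis [FiniteDimensional ℝ V] {L : Submodule ℤ V} [DiscreteTopology L]
    [IsZLattice ℝ L] {ι : Type*} (c : Basis ι ℤ L) :
    ∃ b : Basis ι ℝ V, (∀ i, b i = c i) ∧ Submodule.span ℤ (Set.range b) = L :=
  ⟨c.ofZLatticeBasis ℝ L, fun i => c.ofZLatticeBasis_apply ℝ L i, c.ofZLatticeBasis_span ℝ L⟩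

theorem iso_matrixPolytope (b : Basis (Fin d) ℝ V) (b' : Basis (Fin d) ℝ V')
    (A : Matrix (Fin d) (Fin d) ℤ) :
    Iso (Submodule.span ℤ (Set.range b)) (matrixPolytope b A)
      (Submodule.span ℤ (Set.range b')) (matrixPolytope b' A) := by
  refine ⟨b.equiv b' (Equiv.refl _), fun x => equiv_mem_span_iff b b' _ x, ?_⟩
  refine (image_crossHull (b.equiv b' (Equiv.refl _)).toLinearMap _).trans ?_
  rw [matrixPolytope_eq]
  congr 1
  funext j
  refine (map_columnVectors (b.equiv b' (Equiv.refl _)).toLinearMap b A j).trans ?_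
  simp

theorem matrixPolytope_eq_columnBasis {p : Fin d → Prop} {A : Matrix (Fin d) (Fin d) ℤ}
    (hA : IsWirthBlock p A) (b : Basis (Fin d) ℝ V) :
    matrixPolytope b A = crossHull (columnBasis hA b) := by
  rw [coe_columnBasis, matrixPolytope_eq]

theorem IsWirth.isReflexivePolytope {A : Matrix (Fin d) (Fin d) ℤ} (hA : IsWirth A)
    (b : Basis (Fin d) ℝ V) :
    IsReflexivePolytope (Submodule.span ℤ (Set.range b)) (matrixPolytope b A) := by
  obtain ⟨p, -, h⟩ := (isWirth_iff A).1 hA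
  rw [matrixPolytope_eq_columnBasis h]
  exact (evenFrame_columnBasis h b).isReflexive

theorem IsWirth.isCSCrosspolytope {A : Matrix (Fin d) (Fin d) ℤ} (hA : IsWirth A)
    (b : Basis (Fin d) ℝ V) : IsCSCrosspolytope (matrixPolytope b A) := by
  obtain ⟨p, -, h⟩ := (isWirth_iff A).1 hA
  rw [matrixPolytope_eq_columnBasis h]
  exact isCSCrosspolytope_crossHull _

theorem iso_of_matEquiv (b : Basis (Fin d) ℝ V) {A B : Matrix (Fin d) (Fin d) ℤ}
    (h : MatEquiv A B) :
    Iso (Submodule.span ℤ (Set.range b)) (matrixPolytope b A)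
      (Submodule.span ℤ (Set.range b)) (matrixPolytope b B) := by
  obtain ⟨U, σ, rfl⟩ := h
  have hcomp : ∀ X Y : Matrix (Fin d) (Fin d) ℤ, X * Y = 1 →
      b.constr ℝ (columnVectors b X) ∘ₗ b.constr ℝ (columnVectors b Y) = LinearMap.id := by
    intro X Y hXY
    refine b.ext fun j => ?_
    rw [LinearMap.comp_apply, b.constr_basis, map_columnVectors]
    simp only [b.constr_basis]
    rw [← columnVectors_mul, hXY, columnVectors_one, LinearMap.id_apply]
  have hmem : ∀ (X : Matrix (Fin d) (Fin d) ℤ) (x : V), x ∈ Submodule.span ℤ (Set.range b) →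
      b.constr ℝ (columnVectors b X) x ∈ Submodule.span ℤ (Set.range b) := by
    intro X x hx
    refine map_mem_of_mem_span _ (fun i => ?_) hx
    rw [b.constr_basis]
    exact columnVectors_mem _ _ _
  set g : V ≃ₗ[ℝ] V := LinearEquiv.ofLinearMap (b.constr ℝ (columnVectors b U.1))
    (b.constr ℝ (columnVectors b (U⁻¹).1)) (hcomp _ _ (by simp)) (hcomp _ _ (by simp)) with hg
  refine ⟨g, fun x => ⟨fun hx => ?_, fun hx => hmem _ x hx⟩, ?_⟩
  · have h1 := hmem (U⁻¹).1 _ hx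
    have h2 : b.constr ℝ (columnVectors b (U⁻¹).1) (g x) = x := g.symm_apply_apply x
    rwa [h2] at h1
  · refine (image_crossHull g.toLinearMap _).trans ?_
    rw [matrixPolytope_eq, ← crossHull_reindex (fun i => g.toLinearMap _) σ]
    congr 1
    funext j
    have h1 : columnVectors b (U.1 * A.submatrix id σ) j = columnVectors b (U.1 * A) (σ j) := by
      unfold columnVectors
      simp [Matrix.mul_apply]
    rw [h1, columnVectors_mul]
    refine (map_columnVectors g.toLinearMap b A (σ j)).trans ?_
    simp [hg]

/-- Matrix equivalence allows no sign changes of columns, so the isomorphism is first replaced by a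
sign-free one; its matrix in the lattice basis is the required element of GL_d(ℤ). -/
theorem matEquiv_of_iso {A B : Matrix (Fin d) (Fin d) ℤ} (hA : IsWirth A) (hB : IsWirth B)
    (b : Basis (Fin d) ℝ V)
    (h : Iso (Submodule.span ℤ (Set.range b)) (matrixPolytope b A)
      (Submodule.span ℤ (Set.range b)) (matrixPolytope b B)) : MatEquiv A B := by
  obtain ⟨p, -, hA⟩ := (isWirth_iff A).1 hA
  obtain ⟨q, -, hB⟩ := (isWirth_iff B).1 hB
  rw [matrixPolytope_eq_columnBasis hA, matrixPolytope_eq_columnBasis hB] at h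
  obtain ⟨σ, hσ⟩ := (evenFrame_columnBasis hA b).exists_equiv_of_iso
    (evenFrame_columnBasis hB b) h
  set τ := (columnBasis hA b).equiv (columnBasis hB b) σ with hτ
  have hcol : ∀ j, τ (columnVectors b A j) = columnVectors b B (σ j) := fun j => by
    have := (columnBasis hA b).equiv_apply j (columnBasis hB b) σ
    simpa only [coe_columnBasis] using this
  have hU : ∀ j, τ (b j) ∈ Submodule.span ℤ (Set.range b) := fun j =>
    (hσ _).2 (Submodule.subset_span ⟨j, rfl⟩)
  have hW : ∀ j, τ.symm (b j) ∈ Submodule.span ℤ (Set.range b) := fun j => by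
    rw [← hσ, τ.apply_symm_apply]
    exact Submodule.subset_span ⟨j, rfl⟩
  have hex : ∀ f : Fin d → V, (∀ j, f j ∈ Submodule.span ℤ (Set.range b)) →
      ∃ U : Matrix (Fin d) (Fin d) ℤ, columnVectors b U = f := by
    intro f hf
    choose U hU using fun j => (mem_span_basis_iff b (f j)).1 (hf j)
    refine ⟨Matrix.of fun i j => U j i, funext fun j => b.ext_elem fun i => ?_⟩
    rw [repr_columnVectors, hU, Matrix.of_apply]
  obtain ⟨U, hU⟩ := hex _ hU
  obtain ⟨W, hW⟩ := hex _ hW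
  have hUW : U * W = 1 := by
    refine columnVectors_injective b fun j => ?_
    rw [columnVectors_mul, hU, columnVectors_one]
    have := map_columnVectors τ.toLinearMap b W j
    rw [hW] at this
    simpa using this.symm
  refine ⟨⟨U, W, hUW, mul_eq_one_comm.1 hUW⟩, σ.symm, ?_⟩
  refine columnVectors_injective b fun j => ?_
  change _ = columnVectors b (U * A.submatrix id σ.symm) j
  rw [columnVectors_mul, hU]
  have h1 := map_columnVectors τ.toLinearMap b A (σ.symm j)
  have h2 := hcol (σ.symm j)
  rw [σ.apply_symm_apply] at h2
  rw [← h2]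
  exact h1

end MatrixEquivalence

/-! ### Unit rows, the reduction, and uniqueness of the splitting. -/

section Reduction

variable {V : Type*} [NormedAddCommGroup V] [NormedSpace ℝ V]
variable {d : ℕ}

/-- Row and column i are both zero off the diagonal, so A is block diagonal with a 1×1 block (1),
and the other block is again a Wirth matrix. -/
theorem splits_interval_of_isUnitRow {p : Fin d → Prop} {A : Matrix (Fin d) (Fin d) ℤ}
    (hA : IsWirthBlock p A) (hp : ∀ i j, i ≤ j → p j → p i) {i : Fin d} (hi : IsUnitRow p A i)
    (b : Basis (Fin d) ℝ V) :
    ∃ (k : ℕ) (Q : Set (Fin k → ℝ)), IsFano (stdLattice k) Q ∧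
      Splits (Submodule.span ℤ (Set.range b)) (matrixPolytope b A) intLattice
        (Set.Icc (-1 : ℝ) 1) (stdLattice k) Q := by
  obtain ⟨k, rfl⟩ : ∃ k, d = k + 1 := Nat.exists_eq_succ_of_ne_zero (by
    rintro rfl; exact i.elim0)
  have hrange : ∀ j, j ∉ Set.range i.succAboveEmb → IsUnitRow p A j := by
    intro j hj
    have : j = i := by
      by_contra hne
      exact hj (Fin.exists_succAbove_eq hne)
    rwa [this]
  have hW : IsWirth (A.submatrix i.succAbove i.succAbove) :=
    (isWirth_iff _).2 ⟨_, fun a c hac hc => hp _ _ (i.strictMono_succAbove.monotone hac) hc,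
      hA.submatrix i.succAboveEmb hrange⟩
  set σ : Unit ⊕ Fin k ≃ Fin (k + 1) := (Equiv.sumComm _ _).trans
    ((Equiv.optionEquivSumPUnit (Fin k)).symm.trans (finSuccEquiv' i).symm) with hσ
  have hσl : ∀ u, σ (Sum.inl u) = i := fun u => by simp [hσ]
  have hσr : ∀ j, σ (Sum.inr j) = i.succAbove j := fun j => by simp [hσ]
  have h := splits_of_blocks b (Basis.singleton Unit ℝ) (Pi.basisFun ℝ (Fin k)) σ A
    (fun u j => by rw [hσl, hσr]; exact hi.2 _ (Fin.succAbove_ne i j))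
    (fun j u => by rw [hσl, hσr]; exact hA.col_zero _ _ (Fin.succAbove_ne i j) hi.1)
  refine ⟨k, matrixPolytope (Pi.basisFun ℝ (Fin k)) (A.submatrix i.succAbove i.succAbove),
    (hW.isReflexivePolytope (Pi.basisFun ℝ (Fin k))).1, ?_⟩
  have h1 : Submodule.span ℤ (Set.range (Basis.singleton Unit ℝ)) = intLattice := by
    congr 1
    ext x
    simp
  have h2 : columnVectors (Basis.singleton Unit ℝ) (A.submatrix (fun u => σ (Sum.inl u))
      (fun u => σ (Sum.inl u))) = fun _ : Unit => (1 : ℝ) := by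
    funext u
    simp [columnVectors, hσl, hA.diag_one i hi.1]
  rw [h1, h2, ← Icc_eq_crossHull] at h
  simp only [hσr] at h
  exact h

theorem isOneMinimalWirth_iff_isOneIrreducible {A : Matrix (Fin d) (Fin d) ℤ} (hA : IsWirth A)
    (b : Basis (Fin d) ℝ V) : IsOneMinimalWirth A ↔
      IsOneIrreducible (Submodule.span ℤ (Set.range b)) (matrixPolytope b A) := by
  obtain ⟨p, hp, hA⟩ := (isWirth_iff A).1 hA
  rw [isOneMinimalWirth_iff hA hp]
  constructor
  · intro h
    rw [matrixPolytope_eq_columnBasis hA]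
    refine (evenFrame_columnBasis hA b).isOneIrreducible fun i => ?_
    rw [isIntegralCoord_columnBasis]
    exact h i
  · intro h i hi
    obtain ⟨k, Q, hQ, hs⟩ := splits_interval_of_isUnitRow hA hp hi b
    exact h k Q hQ hs

/-- Converse of `EvenFrame.isOneIrreducible`, obtained through the normal form: an integral
coordinate would be a unit row of a Wirth matrix with these columns. -/
theorem EvenFrame.not_isIntegralCoord {ι : Type*} [Fintype ι] {L : Submodule ℤ V}
    {e : Basis ι ℝ V} (h : EvenFrame L e) (hirr : IsOneIrreducible L (crossHull e)) (i : ι) :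
    ¬ IsIntegralCoord L e i := by
  obtain ⟨A, b, σ, hA, rfl, hcol⟩ := h.exists_isWirth rfl
  have h1 : matrixPolytope b A = crossHull e := by
    rw [matrixPolytope_eq, hcol, crossHull_reindex]
  rw [← h1, ← isOneMinimalWirth_iff_isOneIrreducible hA] at hirr
  obtain ⟨p, hp, hA⟩ := (isWirth_iff A).1 hA
  rw [isOneMinimalWirth_iff hA hp] at hirr
  have h2 : columnBasis hA b = e.reindex σ.symm := by
    refine DFunLike.coe_injective ?_
    rw [coe_columnBasis, hcol]
    funext j
    simp
  intro hi
  refine hirr (σ.symm i) ?_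
  rw [← isIntegralCoord_columnBasis hA b, h2]
  intro x hx
  simpa using hi x hx

theorem IsWirth.isOneMinimalWirth_reduction {A : Matrix (Fin d) (Fin d) ℤ} (hA : IsWirth A) :
    IsOneMinimalWirth (reduction A) := by
  obtain ⟨p, hp, hA⟩ := (isWirth_iff A).1 hA
  set φ := (singleOneRows A)ᶜ.orderEmbOfFin rfl with hφ
  have hrange : ∀ i, i ∉ Set.range φ.toEmbedding → IsUnitRow p A i := by
    intro i hi
    rw [← mem_singleOneRows hA]
    by_contra hno
    refine hi ?_
    have : i ∈ Set.range φ := by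
      rw [hφ, Finset.range_orderEmbOfFin]
      simpa using hno
    exact this
  have hblock : IsWirthBlock (fun k => p (φ k)) (reduction A) := hA.submatrix φ.toEmbedding hrange
  rw [isOneMinimalWirth_iff hblock fun a c hac hc => hp _ _ (φ.monotone hac) hc]
  intro k
  refine hA.not_isUnitRow_submatrix φ.toEmbedding hrange k ?_
  rw [← mem_singleOneRows hA]
  exact Finset.mem_compl.1 (Finset.orderEmbOfFin_mem _ _ k)

theorem IsOneMinimalWirth.isWirth {A : Matrix (Fin d) (Fin d) ℤ} (hA : IsOneMinimalWirth A) :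
    IsWirth A := by
  obtain ⟨f, g, h, C, h0, hC, hAC, -⟩ := hA
  exact ⟨f, g, h, C, h0, hC, hAC⟩

/-- After sorting the unit rows to the end, A is block diagonal with blocks the reduction and an
identity matrix. -/
theorem IsWirth.splitsWithIntervals {A : Matrix (Fin d) (Fin d) ℤ} (hA : IsWirth A)
    (b : Basis (Fin d) ℝ V) :
    SplitsWithIntervals (Submodule.span ℤ (Set.range b)) (matrixPolytope b A) (stdLattice _)
      (reductionPolytope A) (singleOneRows A).card := by
  obtain ⟨p, hp, hA⟩ := (isWirth_iff A).1 hA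
  set σ := finSumEquivOfFinset (s := (singleOneRows A)ᶜ) rfl (congrArg Finset.card
    (compl_compl (singleOneRows A))) with hσ
  have hσl : ∀ k, σ (Sum.inl k) = (singleOneRows A)ᶜ.orderEmbOfFin rfl k := fun k =>
    finSumEquivOfFinset_inl _ _ k
  have hσr : ∀ j, IsUnitRow p A (σ (Sum.inr j)) := fun j => by
    rw [← mem_singleOneRows hA, hσ, finSumEquivOfFinset_inr]
    have := Finset.orderEmbOfFin_mem (singleOneRows A)ᶜᶜ (congrArg Finset.card
      (compl_compl (singleOneRows A))) j
    simpa only [Finset.mem_compl, not_not] using this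
  have hne : ∀ k j, σ (Sum.inl k) ≠ σ (Sum.inr j) := fun k j h => by
    simpa using σ.injective h
  have h := splits_of_blocks b (Pi.basisFun ℝ _) (Pi.basisFun ℝ _) σ A
    (fun k j => hA.col_zero _ _ (hne k j) (hσr j).1) (fun j k => (hσr j).2 _ (hne k j))
  have h2 : A.submatrix (fun j => σ (Sum.inr j)) (fun j => σ (Sum.inr j)) = 1 := by
    ext i j
    rw [Matrix.submatrix_apply, Matrix.one_apply]
    split_ifs with hij
    · rw [hij]
      exact hA.diag_one _ (hσr j).1
    · refine (hσr i).2 _ fun h => hij ?_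
      simpa using (σ.injective h).symm
  rw [h2, show columnVectors (Pi.basisFun ℝ (Fin (singleOneRows A).card)) 1 = _ from
    funext fun j => columnVectors_one _ j, ← intervals_eq_crossHull] at h
  simp only [hσl] at h
  exact h

variable {V₁ : Type*} [NormedAddCommGroup V₁] [NormedSpace ℝ V₁]
variable {V₂ : Type*} [NormedAddCommGroup V₂] [NormedSpace ℝ V₂]

/-- Uniqueness of the splitting into intervals and a polytope without integral coordinates. -/
theorem EvenFrame.unique_splitting {ι₁ ι₂ : Type*} [Fintype ι₁] [Fintype ι₂]
    {L₁ : Submodule ℤ V₁} {L₂ : Submodule ℤ V₂} {e₁ : Basis ι₁ ℝ V₁} {e₂ : Basis ι₂ ℝ V₂}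
    (h₁ : EvenFrame L₁ e₁) (h₂ : EvenFrame L₂ e₂) (hno₁ : ∀ i, ¬ IsIntegralCoord L₁ e₁ i)
    (hno₂ : ∀ i, ¬ IsIntegralCoord L₂ e₂ i) {r s : ℕ}
    (h : Iso (L₁.prod (stdLattice r)) (freeSum (crossHull e₁) (intervals r))
      (L₂.prod (stdLattice s)) (freeSum (crossHull e₂) (intervals s))) :
    r = s ∧ Iso L₁ (crossHull e₁) L₂ (crossHull e₂) := by
  rw [intervals_eq_crossHull, intervals_eq_crossHull, ← crossHull_prod, ← crossHull_prod] at h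
  obtain ⟨τ, hτ⟩ := (h₁.prod (evenFrame_basisFun r)).exists_equiv_of_iso
    (h₂.prod (evenFrame_basisFun s)) h
  -- Interval axes are integral coordinates and the axes of e₁ and e₂ are not, so τ preserves the
  -- two kinds.
  have hl : ∀ i, ∃ k, τ (Sum.inl i) = Sum.inl k := by
    intro i
    rcases hk : τ (Sum.inl i) with k | k
    · exact ⟨k, rfl⟩
    · have h3 := isIntegralCoord_congr hτ (Sum.inl i)
      rw [hk, isIntegralCoord_prod_inr, isIntegralCoord_prod_inl] at h3
      exact absurd (h3.1 (isIntegralCoord_basisFun k)) (hno₁ i)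
  have hr : ∀ k, ∃ i, τ (Sum.inl i) = Sum.inl k := by
    intro k
    rcases hi : τ.symm (Sum.inl k) with i | i
    · exact ⟨i, by rw [← hi, τ.apply_symm_apply]⟩
    · have h3 := isIntegralCoord_congr hτ (Sum.inr i)
      rw [← hi, τ.apply_symm_apply, isIntegralCoord_prod_inl, hi, isIntegralCoord_prod_inr] at h3
      exact absurd (h3.2 (isIntegralCoord_basisFun i)) (hno₂ k)
  choose f hf using hl
  have hbij : Function.Bijective f := by
    refine ⟨fun i j hij => ?_, fun k => ?_⟩
    · have h3 : τ (Sum.inl i) = τ (Sum.inl j) := by rw [hf, hf, hij]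
      simpa using τ.injective h3
    · obtain ⟨i, hi⟩ := hr k
      rw [hf] at hi
      exact ⟨i, by simpa using hi⟩
  set τ₁ := Equiv.ofBijective f hbij with hτ₁
  have hcard := Fintype.card_congr τ
  rw [Fintype.card_sum, Fintype.card_sum, Fintype.card_congr τ₁, Fintype.card_fin,
    Fintype.card_fin] at hcard
  refine ⟨by omega, iso_of_equiv e₁ e₂ τ₁ fun x => ?_⟩
  have h4 : ∀ x, (e₁.prod (Pi.basisFun ℝ (Fin r))).equiv (e₂.prod (Pi.basisFun ℝ (Fin s))) τ
      (x, 0) = (e₁.equiv e₂ τ₁ x, 0) := by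
    intro x
    have h5 : ((e₁.prod (Pi.basisFun ℝ (Fin r))).equiv
        (e₂.prod (Pi.basisFun ℝ (Fin s))) τ).toLinearMap ∘ₗ LinearMap.inl ℝ V₁ (Fin r → ℝ) =
        LinearMap.inl ℝ V₂ (Fin s → ℝ) ∘ₗ (e₁.equiv e₂ τ₁).toLinearMap := by
      refine e₁.ext fun i => ?_
      have h6 : LinearMap.inl ℝ V₁ (Fin r → ℝ) (e₁ i) =
          e₁.prod (Pi.basisFun ℝ (Fin r)) (Sum.inl i) := by simp [Basis.prod_apply]
      rw [LinearMap.comp_apply, h6, LinearEquiv.coe_coe, Basis.equiv_apply, hf]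
      simp [Basis.prod_apply, hτ₁]
    exact LinearMap.congr_fun h5 x
  have h7 := hτ (x, 0)
  rw [h4, Submodule.mem_prod, Submodule.mem_prod] at h7
  simpa using h7

end Reduction

end CSCross

end

/-! ### The main theorem, assembled. -/

theorem theorem2p2 {d : ℕ} {V : Type*} [NormedAddCommGroup V] [NormedSpace ℝ V]
    [FiniteDimensional ℝ V] (hd : Module.finrank ℝ V = d)
    (L : Submodule ℤ V) [DiscreteTopology L] [IsZLattice ℝ L] :
    -- every Wirth matrix defines, in every lattice basis, a reflexive cs-crosspolytope
    (∀ (A : WirthMatrix d) (b : Module.Basis (Fin d) ℤ L),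
      IsReflexivePolytope L (matrixPolytope (fun i => (b i : V)) A.1) ∧
        IsCSCrosspolytope (matrixPolytope (fun i => (b i : V)) A.1)) ∧
    -- this induces a bijection of equivalence classes with isomorphism classes
    ∃ Φ : Quotient (wirthSetoid d) ≃ Quotient (crossSetoid L),
      (∀ (A : WirthMatrix d) (P : ReflexiveCross L),
        Φ (Quotient.mk (wirthSetoid d) A) = Quotient.mk (crossSetoid L) P ↔
          Iso L P.1 (stdLattice d) (matrixPolytope (Pi.basisFun ℝ (Fin d)) A.1)) ∧
      (∀ (A : WirthMatrix d) (P : ReflexiveCross L),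
        Φ (Quotient.mk (wirthSetoid d) A) = Quotient.mk (crossSetoid L) P ↔
          ∃ b : Module.Basis (Fin d) ℤ L, P.1 = matrixPolytope (fun i => (b i : V)) A.1) ∧
      -- the inverse map, through an arbitrary facet
      (∀ (P : ReflexiveCross L) (F : Set V), IsFacet P.1 F →
        ∃ (b : Module.Basis (Fin d) ℤ L) (v : Fin d → L) (A : WirthMatrix d),
          Function.Injective v ∧
          Set.range (fun j => (v j : V)) = F.extremePoints ℝ ∧
          (∀ i j, A.1 i j = b.repr (v j) i) ∧
          Φ.symm (Quotient.mk (crossSetoid L) P) = Quotient.mk (wirthSetoid d) A) ∧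
      -- 1-minimal Wirth matrices correspond to 1-irreducible polytopes
      (∀ (A : WirthMatrix d) (P : ReflexiveCross L),
        Φ (Quotient.mk (wirthSetoid d) A) = Quotient.mk (crossSetoid L) P →
          (IsOneMinimalWirth A.1 ↔ IsOneIrreducible L P.1)) ∧
      -- the unique splitting; its 1-irreducible factor is given by the reduction of `A`
      (∀ (A : WirthMatrix d) (P : ReflexiveCross L),
        Φ (Quotient.mk (wirthSetoid d) A) = Quotient.mk (crossSetoid L) P →
          IsOneMinimalWirth (reduction A.1) ∧
          IsReflexivePolytope (stdLattice _) (reductionPolytope A.1) ∧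
          IsCSCrosspolytope (reductionPolytope A.1) ∧
          IsOneIrreducible (stdLattice _) (reductionPolytope A.1) ∧
          SplitsWithIntervals L P.1 (stdLattice _) (reductionPolytope A.1)
            (singleOneRows A.1).card ∧
          ∀ {W : Type*} [NormedAddCommGroup W] [NormedSpace ℝ W] [FiniteDimensional ℝ W]
            (K : Submodule ℤ W) [DiscreteTopology K] [IsZLattice ℝ K] (Q : Set W) (s : ℕ),
            IsReflexivePolytope K Q → IsCSCrosspolytope Q → IsOneIrreducible K Q →
            SplitsWithIntervals L P.1 K Q s →
              s = (singleOneRows A.1).card ∧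
                Iso K Q (stdLattice _) (reductionPolytope A.1)) := by
  classical
  have hmod : Module.Finite ℤ L := ZLattice.module_finite ℝ L
  have hfree : Module.Free ℤ L := ZLattice.module_free ℝ L
  obtain ⟨b₀, -, hb₀⟩ := exists_real_basis
    (Module.finBasisOfFinrankEq ℤ L ((ZLattice.rank ℝ L).trans hd))
  have hwirth : ∀ (A : WirthMatrix d) (b : Module.Basis (Fin d) ℤ L),
      IsReflexivePolytope L (matrixPolytope (fun i => (b i : V)) A.1) ∧
        IsCSCrosspolytope (matrixPolytope (fun i => (b i : V)) A.1) := by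
    intro A b
    obtain ⟨b', hb', hspan⟩ := exists_real_basis b
    rw [show (fun i => (b i : V)) = b' from funext fun i => (hb' i).symm]
    exact ⟨by simpa only [hspan] using A.2.isReflexivePolytope b', A.2.isCSCrosspolytope b'⟩
  refine ⟨hwirth, ?_⟩
  set F : WirthMatrix d → ReflexiveCross L := fun A => ⟨matrixPolytope b₀ A.1,
    by simpa only [hb₀] using A.2.isReflexivePolytope b₀, A.2.isCSCrosspolytope b₀⟩ with hF
  have hisoL : ∀ (A : WirthMatrix d) (b : Module.Basis (Fin d) ℝ V),
      Submodule.span ℤ (Set.range b) = L →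
        Iso L (matrixPolytope b₀ A.1) L (matrixPolytope b A.1) := by
    intro A b hb
    simpa only [hb₀, hb] using iso_matrixPolytope b₀ b A.1
  have hexists : ∀ {e : Module.Basis (Fin (Module.finrank ℝ V)) ℝ V}, EvenFrame L e →
      ∃ (A : WirthMatrix d) (b : Module.Basis (Fin d) ℝ V)
        (σ : Fin d ≃ Fin (Module.finrank ℝ V)), Submodule.span ℤ (Set.range b) = L ∧
        columnVectors b A.1 = fun j => e (σ j) := by
    intro e he
    obtain ⟨A, b, σ, hA, hb, hcol⟩ := he.exists_isWirth (d := d) (by simpa using hd)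
    exact ⟨⟨A, hA⟩, b, σ, hb, hcol⟩
  -- The map is built from one fixed lattice basis; by `hisoL` another basis gives an isomorphic
  -- polytope.
  set Φ₀ : Quotient (wirthSetoid d) → Quotient (crossSetoid L) :=
    Quotient.map F fun A B hAB => by
      have h := iso_of_matEquiv b₀ hAB
      rw [hb₀] at h
      exact h with hΦ₀
  have hbij : Function.Bijective Φ₀ := by
    constructor
    · intro x y
      induction x using Quotient.inductionOn with | _ A
      induction y using Quotient.inductionOn with | _ B
      intro hAB
      refine Quotient.sound (matEquiv_of_iso A.2 B.2 b₀ ?_)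
      rw [hb₀]
      exact Quotient.exact hAB
    · intro y
      induction y using Quotient.inductionOn with | _ P
      obtain ⟨P, hP, e, rfl⟩ := P
      obtain ⟨A, b, σ, hb, hcol⟩ := hexists (evenFrame_of_isReflexive hP)
      refine ⟨Quotient.mk _ A, Quotient.sound ?_⟩
      have h := hisoL A b hb
      rw [matrixPolytope_eq b, hcol, crossHull_reindex] at h
      exact h
  have hiff : ∀ (A : WirthMatrix d) (P : ReflexiveCross L),
      Equiv.ofBijective Φ₀ hbij (Quotient.mk (wirthSetoid d) A) =
        Quotient.mk (crossSetoid L) P ↔ Iso L (matrixPolytope b₀ A.1) L P.1 :=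
    fun A P => ⟨fun h => Quotient.exact h, fun h => Quotient.sound h⟩
  have hiff' : ∀ (A : WirthMatrix d) (P : ReflexiveCross L),
      Equiv.ofBijective Φ₀ hbij (Quotient.mk (wirthSetoid d) A) =
        Quotient.mk (crossSetoid L) P ↔ ∃ b : Module.Basis (Fin d) ℝ V,
          Submodule.span ℤ (Set.range b) = L ∧ P.1 = matrixPolytope b A.1 := by
    intro A P
    rw [hiff]
    constructor
    · rintro ⟨g, hg, hgP⟩
      -- An isomorphism onto P is absorbed into the basis, so that P is equal, not just isomorphic,
      -- to a matrix polytope.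
      refine ⟨b₀.map g, ?_, ?_⟩
      · ext x
        have h1 := equiv_mem_span_iff b₀ (b₀.map g) (Equiv.refl _) (g.symm x)
        have h2 : b₀.equiv (b₀.map g) (Equiv.refl _) = g :=
          b₀.ext' fun i => by simp
        rw [h2, g.apply_symm_apply, hb₀, ← hg, g.apply_symm_apply] at h1
        exact h1
      · rw [← hgP, matrixPolytope_eq, matrixPolytope_eq]
        refine (image_crossHull g.toLinearMap _).trans ?_
        congr 1
        funext j
        exact (map_columnVectors g.toLinearMap b₀ A.1 j).trans
          (congrArg (fun f => columnVectors f A.1 j) (funext fun i => (b₀.map_apply g i).symm))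
    · rintro ⟨b, hb, hP⟩
      rw [hP]
      exact hisoL A b hb
  have hiff'' : ∀ (A : WirthMatrix d) (P : ReflexiveCross L),
      Equiv.ofBijective Φ₀ hbij (Quotient.mk (wirthSetoid d) A) =
        Quotient.mk (crossSetoid L) P ↔
          ∃ b : Module.Basis (Fin d) ℤ L, P.1 = matrixPolytope (fun i => (b i : V)) A.1 := by
    intro A P
    rw [hiff']
    constructor
    · rintro ⟨b, hb, hP⟩
      obtain ⟨c, hc⟩ := exists_int_basis b hb
      exact ⟨c, by rw [hP, funext hc]⟩
    · rintro ⟨c, hP⟩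
      obtain ⟨b, hb, hspan⟩ := exists_real_basis c
      exact ⟨b, hspan, by rw [hP, funext hb]⟩
  refine ⟨Equiv.ofBijective Φ₀ hbij, fun A P => ?_, hiff'', fun P F hF => ?_, fun A P h => ?_,
    fun A P h => ?_⟩
  · have hstd : Iso L (matrixPolytope b₀ A.1) (stdLattice d)
        (matrixPolytope (Pi.basisFun ℝ (Fin d)) A.1) := by
      simpa only [hb₀] using iso_matrixPolytope b₀ (Pi.basisFun ℝ (Fin d)) A.1
    rw [hiff]
    exact ⟨fun h => h.symm.trans hstd, fun h => hstd.trans h.symm⟩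
  · obtain ⟨P, hP, e, rfl⟩ := P
    obtain ⟨e', hpm, hrange⟩ := exists_basis_of_isFacet e hF
    -- The facet vertices differ from the frame only by signs, so they are a frame of the same
    -- polytope, to which the normal form applies.
    have hcross : crossHull e' = crossHull e := crossHull_sign _ _ hpm
    have he' : EvenFrame L e' := evenFrame_of_isReflexive (by rwa [hcross])
    obtain ⟨A, b, σ, hb, hcol⟩ := hexists he'
    obtain ⟨c, hc⟩ := exists_int_basis b hb
    refine ⟨c, fun j => ⟨e' (σ j), he'.mem _⟩, A, fun i j hij => ?_, ?_, fun i j => ?_, ?_⟩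
    · exact σ.injective (e'.injective (congrArg Subtype.val hij))
    · rw [← hrange]
      exact σ.surjective.range_comp e'
    · have h1 : (⟨e' (σ j), he'.mem _⟩ : L) = ∑ k, A.1 k j • c k := by
        refine Subtype.ext ?_
        exact (congrFun hcol j).symm.trans (by simp [columnVectors, hc])
      change A.1 i j = c.repr ⟨e' (σ j), he'.mem _⟩ i
      rw [h1, c.repr_sum_self]
    · refine (Equiv.symm_apply_eq _).2 ((hiff' A ⟨crossHull e, hP, e, rfl⟩).2 ⟨b, hb, ?_⟩).symm
      change crossHull e = matrixPolytope b A.1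
      rw [matrixPolytope_eq, hcol, crossHull_reindex, hcross]
  · obtain ⟨b, hb, hP⟩ := (hiff' A P).1 h
    rw [hP, isOneMinimalWirth_iff_isOneIrreducible A.2 b, hb]
  · obtain ⟨b, hb, hP⟩ := (hiff' A P).1 h
    have hmin := A.2.isOneMinimalWirth_reduction
    have hred := hmin.isWirth
    have hrefl := hred.isReflexivePolytope (Pi.basisFun ℝ _)
    have hirr := (isOneMinimalWirth_iff_isOneIrreducible hred (Pi.basisFun ℝ _)).1 hmin
    have hsplit := A.2.splitsWithIntervals b
    rw [hb, ← hP] at hsplit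
    have hcs := hred.isCSCrosspolytope (Pi.basisFun ℝ _)
    refine ⟨hmin, hrefl, hcs, hirr, hsplit, ?_⟩
    intro W _ _ _ K _ _ Q s hQ hQcs hQirr hQsplit
    obtain ⟨q, rfl⟩ := hQcs
    obtain ⟨p, -, hblock⟩ := (isWirth_iff _).1 hred
    have hE := evenFrame_columnBasis hblock (Pi.basisFun ℝ _)
    have hpoly : reductionPolytope A.1 = crossHull (columnBasis hblock (Pi.basisFun ℝ _)) :=
      matrixPolytope_eq_columnBasis hblock _
    have hirr' : IsOneIrreducible (stdLattice _) (reductionPolytope A.1) := hirr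
    rw [hpoly] at hirr' hsplit ⊢
    have hq := evenFrame_of_isReflexive hQ
    exact hq.unique_splitting hE (hq.not_isIntegralCoord hQirr)
      (hE.not_isIntegralCoord hirr') (hQsplit.symm.trans hsplit)
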